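/- Let $p,q\ge 0$, $n=p+q$, and let $Cl_{p,q}$ be the real Clifford algebra generated by $\gamma_1,\dots,\gamma_n$ with $\gamma_i^2=1$ for $i\le p$, $\gamma_i^2=-1$ for $i>p$, and $\gamma_i\gamma_j=-\gamma_j\gamma_i$ for $i\ne j$. Write $\gamma_{i_1,\dots,i_r}=\gamma_{i_1}\cdots\gamma_{i_r}$, and $\gamma_X=\{\gamma_\alpha:\alpha\in X\}$ for a set $X$ of multi-indices. For $s,l\ge 0$ put $$B(s,l)=\bigcup_{i=0}^{l-1}\{(t_i+1,t_i+2,t_i+3,t_i+4),\ (t_i+1,t_i+2,t_i+5,t_i+6),\ (t_i+1,t_i+2,t_i+7,t_i+8),\ (t_i+1,t_i+3,t_i+5,t_i+7)\},\quad t_i=s+8i.$$ Let the Radon–Hurwitz numbers be given by $r_0=0$, $r_1=1$, $r_2=r_3=2$, $r_4=r_5=r_6=r_7=3$, $r_{i+8}=r_i+4$ for $i\ge0$, $r_{-1}=-1$, and $r_{-i}=1-i+r_{i-2}$ for $i\ge 2$. Every signature has the form $(p,p+8l+a)$ or $(q+8l+a,q)$ with $l\ge0$ and $0\le a\le 7$.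 Define a set $G\subset Cl_{p,q}$ and a number $k$ as follows. (1) Signature $(p,p+8l+a)$. Let $P_2=\{(i,p+i):1\le i\le p\}$, $P_4=B(2p,l)$, $m=2p+8l$, and $G=\gamma_{P_2}\cup\gamma_{P_4}\cup E$, where - $a=0,1,2$: $E=\emptyset$, $k=p+4l$; - $a=3$: $E=\{\gamma_{m+1,m+2,m+3}\}$, $k=p+4l+1$; - $a=4$: $E=\{\gamma_{m+1,m+2,m+3,m+4}\}$, $k=p+4l+1$; - $a=5$: $E=\{\gamma_{m+1,m+2,m+3,m+4},\gamma_{m+1,m+2,m+5}\}$, $k=p+4l+2$; - $a=6$: $E=\{\gamma_{m+1,m+2,m+4},\gamma_{m+2,m+3,m+5},\gamma_{m+3,m+4,m+6}\}$, $k=p+4l+3$; - $a=7$: $E=\{\gamma_{m+1,m+2,m+4},\gamma_{m+2,m+3,m+5},\gamma_{m+3,m+4,m+6},\gamma_{m+4,m+5,m+7}\}$, $k=p+4l+4$. (2) Signature $(q+8l+a,q)$. Let $Q_2=\{(i,q+8l+a+i):1\le i\le q\}$, $Q_4=B(q,l)$, $m=q+8l$, and $G=\gamma_{Q_2}\cup\gamma_{Q_4}\cup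 E$, where - $a=0$: $E=\emptyset$, $k=q+4l$; - $a=1,2,3,4$: $E=\{\gamma_{m+1}\}$, $k=q+4l+1$; - $a=5$: $E=\{\gamma_{m+1,m+2,m+3,m+4},\gamma_{m+5}\}$, $k=q+4l+2$; - $a=6$: $E=\{\gamma_{m+1,m+2,m+3,m+4},\gamma_{m+1,m+2,m+5,m+6}\}$, $k=q+4l+2$; - $a=7$: $E=\{\gamma_{m+1,m+2,m+3,m+4},\gamma_{m+1,m+2,m+5,m+6},\gamma_{m+7}\}$, $k=q+4l+3$. Then in every case, for the signature in question (denoted $(p,q)$ again, with $n=p+q$): $G$ consists of basis $1$-, $2$-, $3$- and $4$-vectors (products $\gamma_{i_1}\cdots\gamma_{i_r}$ with $1\le i_1<\dots<i_r\le n$) and has exactly $k=q-r_{q-p}$ elements, which are mutually commuting and square to $1$, and none of which is a product of other elements of $G$. The element $F=\prod_{g\in G}\frac{1+g}{2}$ is a primitive idempotent (a nonzero idempotent that is not the sum of two nonzero idempotents annihilating each other), and $Cl_{p,q}F$ is a minimal left ideal of real dimension $2^{n-k}$. -/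

import Mathlib

noncomputable section

namespace CliffordTables

/-- The quadratic form of `ℝ^{p,q}`: the first `p` coordinate vectors have square `1`,
the remaining `q` have square `-1`. -/
def quadForm (p q : ℕ) : QuadraticForm ℝ (Fin (p + q) → ℝ) :=
  QuadraticMap.weightedSumSquares ℝ (fun j : Fin (p + q) => if (j : ℕ) < p then (1 : ℝ) else -1)

/-- The real Clifford algebra `Cl_{p,q}`, in the convention `v * v = Q(v)`. -/
abbrev Cl (p q : ℕ) : Type := CliffordAlgebra (quadForm p q)

/-- The generator `γ_i`, for `1 ≤ i ≤ p + q` (indices start at `1`, as is usual in print;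
for `i` outside this range the vector is zero). -/
def gamma (p q i : ℕ) : Cl p q :=
  CliffordAlgebra.ι (quadForm p q) (fun j : Fin (p + q) => if (j : ℕ) + 1 = i then 1 else 0)

/-- `γ_α = γ_{i₁} ⋯ γ_{iᵣ}` for a multi-index `α = (i₁, …, iᵣ)`. -/
def gammaMono (p q : ℕ) (α : List ℕ) : Cl p q := (α.map (gamma p q)).prod

/-- `α = (i₁ < ⋯ < iᵣ)` with all entries in `{1, …, n}` and `1 ≤ r ≤ 4`, so that `γ_α` is an
`r`-vector of the canonical basis, `1 ≤ r ≤ 4`. -/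
def IsBasisIndex (n : ℕ) (α : List ℕ) : Prop :=
  α.Pairwise (· < ·) ∧ (∀ i ∈ α, 1 ≤ i ∧ i ≤ n) ∧ 1 ≤ α.length ∧ α.length ≤ 4

/-- Radon–Hurwitz numbers `r_i` for `i ≥ 0`. -/
def radonHurwitzNat : ℕ → ℤ
  | 0 => 0
  | 1 => 1
  | 2 => 2
  | 3 => 2
  | 4 => 3
  | 5 => 3
  | 6 => 3
  | 7 => 3
  | i + 8 => radonHurwitzNat i + 4

/-- Radon–Hurwitz numbers for all integers: `r_{-1} = -1`, and `r_{-i} = 1 - i + r_{i-2}` for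
`i ≥ 2` (here `Int.negSucc (j + 1) = -(j + 2)`). -/
def radonHurwitz : ℤ → ℤ
  | Int.ofNat i => radonHurwitzNat i
  | Int.negSucc 0 => -1
  | Int.negSucc (j + 1) => 1 - ((j : ℤ) + 2) + radonHurwitzNat j

/-- The pairs `(i, s + i)`, `1 ≤ i ≤ m`. -/
def pairs (m s : ℕ) : List (List ℕ) := (List.range m).map fun i => [i + 1, s + (i + 1)]

/-- The `4 l` quadruples obtained from `l` consecutive blocks of eight indices, the first block
starting after the index `s` (here `i` runs over `0, …, l - 1`). -/
def quads (s l : ℕ) : List (List ℕ) := (List.range l).flatMap fun i =>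
  [[s + 8 * i + 1, s + 8 * i + 2, s + 8 * i + 3, s + 8 * i + 4],
   [s + 8 * i + 1, s + 8 * i + 2, s + 8 * i + 5, s + 8 * i + 6],
   [s + 8 * i + 1, s + 8 * i + 2, s + 8 * i + 7, s + 8 * i + 8],
   [s + 8 * i + 1, s + 8 * i + 3, s + 8 * i + 5, s + 8 * i + 7]]

/-- `P₂ = {(1, p+1), …, (p, 2p)}`, for signature `(p, p + 8l + a)`. -/
def P2 (p : ℕ) : List (List ℕ) := pairs p p

/-- `P₄`, for signature `(p, p + 8l + a)`. -/
def P4 (p l : ℕ) : List (List ℕ) := quads (2 * p) l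

/-- `Q₂ = {(1, q+8l+a+1), …, (q, 2q+8l+a)}`, for signature `(q + 8l + a, q)`. -/
def Q2 (q l a : ℕ) : List (List ℕ) := pairs q (q + 8 * l + a)

/-- `Q₄`, for signature `(q + 8l + a, q)`. -/
def Q4 (q l : ℕ) : List (List ℕ) := quads q l

/-- The additional multi-indices for signature `(p, p + 8l + a)`, with `m = 2p + 8l`. -/
def extraP (m : ℕ) : ℕ → List (List ℕ)
  | 3 => [[m + 1, m + 2, m + 3]]
  | 4 => [[m + 1, m + 2, m + 3, m + 4]]
  | 5 => [[m + 1, m + 2, m + 3, m + 4], [m + 1, m + 2, m + 5]]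
  | 6 => [[m + 1, m + 2, m + 4], [m + 2, m + 3, m + 5], [m + 3, m + 4, m + 6]]
  | 7 => [[m + 1, m + 2, m + 4], [m + 2, m + 3, m + 5], [m + 3, m + 4, m + 6],
          [m + 4, m + 5, m + 7]]
  | _ => []

/-- The additional multi-indices for signature `(q + 8l + a, q)`, with `m = q + 8l`. -/
def extraQ (m : ℕ) : ℕ → List (List ℕ)
  | 1 => [[m + 1]]
  | 2 => [[m + 1]]
  | 3 => [[m + 1]]
  | 4 => [[m + 1]]
  | 5 => [[m + 1, m + 2, m + 3, m + 4], [m + 5]]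
  | 6 => [[m + 1, m + 2, m + 3, m + 4], [m + 1, m + 2, m + 5, m + 6]]
  | 7 => [[m + 1, m + 2, m + 3, m + 4], [m + 1, m + 2, m + 5, m + 6], [m + 7]]
  | _ => []

/-- The multi-indices listed for signature `(p, p + 8l + a)`, `0 ≤ a ≤ 7`. -/
def tableP (p l a : ℕ) : List (List ℕ) := P2 p ++ P4 p l ++ extraP (2 * p + 8 * l) a

/-- The multi-indices listed for signature `(q + 8l + a, q)`, `0 ≤ a ≤ 7`. -/
def tableQ (q l a : ℕ) : List (List ℕ) := Q2 q l a ++ Q4 q l ++ extraQ (q + 8 * l) a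

/-- The number `k` listed for signature `(p, p + 8l + a)`, `0 ≤ a ≤ 7`. -/
def kP (p l : ℕ) : ℕ → ℕ
  | 3 => p + 4 * l + 1
  | 4 => p + 4 * l + 1
  | 5 => p + 4 * l + 2
  | 6 => p + 4 * l + 3
  | 7 => p + 4 * l + 4
  | _ => p + 4 * l

/-- The number `k` listed for signature `(q + 8l + a, q)`, `0 ≤ a ≤ 7`. -/
def kQ (q l : ℕ) : ℕ → ℕ
  | 1 => q + 4 * l + 1
  | 2 => q + 4 * l + 1
  | 3 => q + 4 * l + 1
  | 4 => q + 4 * l + 1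
  | 5 => q + 4 * l + 2
  | 6 => q + 4 * l + 2
  | 7 => q + 4 * l + 3
  | _ => q + 4 * l

/-- The set `{γ_α : α ∈ L}` in `Cl_{p,q}`. -/
def gammaSet (p q : ℕ) (L : List (List ℕ)) : Set (Cl p q) := {g | ∃ α ∈ L, gammaMono p q α = g}

/-- The product `F = ∏_{α ∈ L} (1 + γ_α) / 2`, in the order of the list `L`. -/
def idem (p q : ℕ) (L : List (List ℕ)) : Cl p q :=
  (L.map fun α => (1 / 2 : ℝ) • (1 + gammaMono p q α)).prod

/-- A generating set for `Cl_{p,q}`: a set of `k = q - r_{q-p}` mutually commuting involutions,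
none of which is a product of others. -/
structure IsGeneratingSet (p q : ℕ) (G : Set (Cl p q)) : Prop where
  finite : G.Finite
  card : (G.ncard : ℤ) = (q : ℤ) - radonHurwitz ((q : ℤ) - (p : ℤ))
  involution : ∀ g ∈ G, g * g = 1
  commute : ∀ g ∈ G, ∀ h ∈ G, g * h = h * g
  independent : ∀ g ∈ G, g ∉ Submonoid.closure (G \ {g})

/-- A primitive idempotent: a nonzero idempotent that is not the sum of two nonzero idempotents
annihilating each other. -/
def IsPrimitiveIdempotent {A : Type*} [Ring A] (F : A) : Prop :=
  F ≠ 0 ∧ F * F = F ∧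
    ∀ e f : A, e * e = e → f * f = f → e * f = 0 → f * e = 0 → e + f = F → e = 0 ∨ f = 0

/-- The left ideal `A F = {x F : x ∈ A}`. -/
def leftIdeal {A : Type*} [Ring A] (F : A) : Ideal A := Ideal.span {F}

end CliffordTables

end

/-! Up to sign, a product of generators depends only on the parity vector of its word over F₂, and
two such products either commute or anticommute according to lengths and overlaps. Questions about
monomials thus become questions about binary codes. Two tools link the codes to the algebra: the
trace `tr` of right multiplication, which vanishes on every word of nonzero parity, and the
anti-automorphism `conj`, which inverts every monomial and satisfies tr (conj x * x) > 0 for x ≠ 0.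

For k commuting involutions with independent parity vectors (`Triangular`), only the term 1 in the
expansion of F has a trace, so tr F = 2^n / 2^k. Hence F ≠ 0. Right multiplication by F projects
onto the left ideal, so its dimension is 2^(n-k). Dropping an involution doubles the trace, so none
is a product of the others.

Primitivity and minimality come from `IsMaximal`. Under it, F * (y + conj y) * F is a real multiple
of F for every y: monomials squaring to -1 cancel, those anticommuting with some factor are killed,
and the rest act on F as signs. For nonzero x = x * F, positivity then makes conj x * x a nonzero
multiple of F, so x generates the ideal (`exists_mul_eq_idem`).

Maximality is proved by splitting the table (`isMaximal_append`). The pairs and quadruples form a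
basis of a self-dual code. A monomial commuting with them agrees on their letters with a codeword,
which F absorbs. What remains is a word in at most seven letters, settled by enumeration. -/

noncomputable section

namespace CliffordTables

variable {p q : ℕ}

/-! ### Words in the generators and their signs -/

/-- The square of the generator `γ_i`. -/
def sgn (p i : ℕ) : ℝ := if i ≤ p then 1 else -1

/-- All letters of the word lie in `{1, …, n}`. -/
def IsWord (n : ℕ) (α : List ℕ) : Prop := ∀ i ∈ α, 1 ≤ i ∧ i ≤ n

lemma isWord_nil (n : ℕ) : IsWord n [] := by simp [IsWord]

lemma isWord_cons {n i : ℕ} {α : List ℕ} :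
    IsWord n (i :: α) ↔ (1 ≤ i ∧ i ≤ n) ∧ IsWord n α := by simp [IsWord]

lemma isWord_append {n : ℕ} {α β : List ℕ} :
    IsWord n (α ++ β) ↔ IsWord n α ∧ IsWord n β := by
  simp only [IsWord, List.mem_append]
  grind

lemma isWord_flatten {n : ℕ} {T : List (List ℕ)} (h : ∀ α ∈ T, IsWord n α) :
    IsWord n T.flatten := by
  intro i hi
  obtain ⟨α, hα, hiα⟩ := List.mem_flatten.1 hi
  exact h α hα i hiα

@[simp] lemma gammaMono_nil : gammaMono p q [] = 1 := rfl

@[simp] lemma gammaMono_cons (i : ℕ) (α : List ℕ) :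
    gammaMono p q (i :: α) = gamma p q i * gammaMono p q α := by simp [gammaMono]

@[simp] lemma gammaMono_append (α β : List ℕ) :
    gammaMono p q (α ++ β) = gammaMono p q α * gammaMono p q β := by simp [gammaMono]

lemma sgn_mul_self (i : ℕ) : sgn p i * sgn p i = 1 := by
  unfold sgn; split_ifs <;> norm_num

lemma gamma_mul_self {i : ℕ} (h1 : 1 ≤ i) (h2 : i ≤ p + q) :
    gamma p q i * gamma p q i = sgn p i • 1 := by
  rw [gamma, CliffordAlgebra.ι_sq_scalar, Algebra.algebraMap_eq_smul_one]
  congr 1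
  -- Letters start at 1 and coordinates at 0, hence the index `i - 1`.
  rw [quadForm, QuadraticMap.weightedSumSquares_apply, Finset.sum_eq_single ⟨i - 1, by omega⟩]
  · have : i - 1 + 1 = i := by omega
    simp only [this, sgn, if_true, smul_eq_mul]
    split_ifs <;> first | omega | norm_num
  · intro j _ hj
    have : ¬ ((j : ℕ) + 1 = i) := fun h => hj (Fin.ext (by simp; omega))
    simp [this]
  · simp

lemma gamma_mul_gamma {i j : ℕ} (h : i ≠ j) :
    gamma p q i * gamma p q j = -(gamma p q j * gamma p q i) := by
  refine CliffordAlgebra.ι_mul_ι_comm_of_isOrtho ?_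
  rw [QuadraticMap.isOrtho_def]
  simp only [quadForm, QuadraticMap.weightedSumSquares_apply, ← Finset.sum_add_distrib]
  refine Finset.sum_congr rfl fun k _ => ?_
  by_cases h1 : (k : ℕ) + 1 = i
  · have h2 : (k : ℕ) + 1 ≠ j := by omega
    simp [h1, h]
  · simp [h1]

/-- Each letter of `β` other than `i` contributes a sign. Their number has the parity of `β.length +
β.count i`, which avoids a subtraction in ℕ. -/
lemma gamma_mul_gammaMono (i : ℕ) (β : List ℕ) :
    gamma p q i * gammaMono p q β =
      (-1 : ℝ) ^ (β.length + β.count i) • (gammaMono p q β * gamma p q i) := by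
  induction β with
  | nil => simp
  | cons j β ih =>
    by_cases h : i = j
    · subst h
      conv_lhs => rw [gammaMono_cons, ih]
      simp only [gammaMono_cons, List.length_cons, List.count_cons_self, mul_smul_comm, mul_assoc]
      congr 1
      ring
    · rw [gammaMono_cons, ← mul_assoc, gamma_mul_gamma h, neg_mul, mul_assoc, ih]
      rw [List.count_cons_of_ne (Ne.symm h), List.length_cons, mul_smul_comm, ← mul_assoc,
        ← neg_smul]
      congr 1
      ring

/-- The number of pairs of equal letters, one in `α` and one in `β`. -/
def coincidences (α β : List ℕ) : ℕ := (α.map fun i => β.count i).sum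

lemma gammaMono_mul_gammaMono (α β : List ℕ) :
    gammaMono p q α * gammaMono p q β =
      (-1 : ℝ) ^ (α.length * β.length + coincidences α β) •
        (gammaMono p q β * gammaMono p q α) := by
  induction α with
  | nil => simp [coincidences]
  | cons i α ih =>
    rw [gammaMono_cons, mul_assoc, ih, mul_smul_comm, ← mul_assoc, gamma_mul_gammaMono,
      smul_mul_assoc, smul_smul, mul_assoc]
    congr 1
    simp only [coincidences, List.length_cons, List.map_cons, List.sum_cons]
    ring

/-- Carrying the first letter of the second copy across the remaining letters of the first costs one
sign per letter; these costs add up to a triangular number. -/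
lemma gammaMono_mul_self_of_nodup {α : List ℕ} (hα : IsWord (p + q) α) (hn : α.Nodup) :
    gammaMono p q α * gammaMono p q α =
      ((-1 : ℝ) ^ (α.length * (α.length - 1) / 2) * (α.map (sgn p)).prod) • 1 := by
  induction α with
  | nil => simp
  | cons i α ih =>
    rw [isWord_cons] at hα
    rw [List.nodup_cons] at hn
    have hswap : gammaMono p q α * gamma p q i =
        (-1 : ℝ) ^ α.length • (gamma p q i * gammaMono p q α) := by
      rw [gamma_mul_gammaMono, List.count_eq_zero_of_not_mem hn.1, smul_smul, ← pow_add]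
      simp
    have htri : (α.length + 1) * (α.length + 1 - 1) / 2
        = α.length + α.length * (α.length - 1) / 2 := by
      have := Nat.triangle_succ α.length
      rw [this]
      omega
    rw [gammaMono_cons, mul_assoc, ← mul_assoc (gammaMono p q α), hswap, smul_mul_assoc,
      mul_assoc, ih hα.2 hn.2, mul_smul_comm, mul_smul_comm, mul_smul_comm, mul_one,
      gamma_mul_self hα.1.1 hα.1.2]
    simp only [smul_smul, List.length_cons, List.map_cons, List.prod_cons, htri]
    congr 1
    ring

lemma gammaMono_mul_self {α : List ℕ} (hα : IsWord (p + q) α) :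
    gammaMono p q α * gammaMono p q α = 1 ∨ gammaMono p q α * gammaMono p q α = -1 := by
  induction α with
  | nil => simp
  | cons i α ih =>
    rw [isWord_cons] at hα
    have hswap : gammaMono p q α * gamma p q i =
        (-1 : ℝ) ^ (α.length + α.count i) • (gamma p q i * gammaMono p q α) := by
      rw [gamma_mul_gammaMono, smul_smul, ← mul_pow]
      simp
    have hi : gamma p q i * gamma p q i = 1 ∨ gamma p q i * gamma p q i = -1 := by
      rw [gamma_mul_self hα.1.1 hα.1.2, sgn]
      split_ifs <;> simp
    have key : gammaMono p q (i :: α) * gammaMono p q (i :: α) =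
        (-1 : ℝ) ^ (α.length + α.count i) •
          ((gamma p q i * gamma p q i) * (gammaMono p q α * gammaMono p q α)) := by
      rw [gammaMono_cons, mul_assoc, ← mul_assoc (gammaMono p q α), hswap, smul_mul_assoc,
        mul_smul_comm]
      simp only [mul_assoc]
    rw [key]
    rcases neg_one_pow_eq_or ℝ (α.length + α.count i) with h | h <;> rcases hi with h' | h' <;>
      rcases ih hα.2 with h'' | h'' <;> rw [h, h', h''] <;> simp

lemma isUnit_gammaMono {α : List ℕ} (hα : IsWord (p + q) α) : IsUnit (gammaMono p q α) := by
  rcases gammaMono_mul_self hα with h | h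
  · exact ⟨⟨_, _, h, h⟩, rfl⟩
  · exact ⟨⟨gammaMono p q α, -gammaMono p q α, by simp [h], by simp [h]⟩, rfl⟩

/-! ### Parity vectors determine monomials up to sign -/

/-- The parity vector of a word. -/
def par (α : List ℕ) (i : ℕ) : ZMod 2 := (α.count i : ZMod 2)

lemma par_append (α β : List ℕ) : par (α ++ β) = par α + par β := by
  ext i; simp [par]

/-- The first letter must occur again; moving the two copies together and cancelling them shortens
the word by two without changing its parity. -/
lemma gammaMono_of_par_eq_zero {α : List ℕ} (hα : IsWord (p + q) α) (h : par α = 0) :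
    gammaMono p q α = 1 ∨ gammaMono p q α = -1 := by
  induction hN : α.length using Nat.strong_induction_on generalizing α with
  | _ N ih =>
    cases α with
    | nil => simp
    | cons i α =>
      have hi : i ∈ α := by
        by_contra hi
        have := congrFun h i
        simp [par, List.count_eq_zero_of_not_mem hi] at this
      obtain ⟨β, δ, rfl⟩ := List.append_of_mem hi
      rw [isWord_cons, isWord_append, isWord_cons] at hα
      have hpar : par (β ++ δ) = 0 := by
        ext j
        have := congrFun h j
        by_cases hij : i = j
        · subst hij
          simp only [par, List.count_cons_self, List.count_append, Nat.cast_add, Nat.cast_one,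
            Pi.zero_apply] at this ⊢
          have h2 : (1 : ZMod 2) + 1 = 0 := by decide
          linear_combination this - h2
        · simpa [par, List.count_cons_of_ne hij] using this
      have hw : IsWord (p + q) (β ++ δ) := isWord_append.2 ⟨hα.2.1, hα.2.2.2⟩
      have key : gammaMono p q (i :: (β ++ i :: δ)) =
          ((-1 : ℝ) ^ (β.length + β.count i) * sgn p i) • gammaMono p q (β ++ δ) := by
        rw [gammaMono_cons, gammaMono_append, gammaMono_cons, ← mul_assoc, gamma_mul_gammaMono,
          smul_mul_assoc, mul_assoc, ← mul_assoc (gamma p q i), gamma_mul_self hα.1.1 hα.1.2,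
          smul_one_mul, mul_smul_comm, smul_smul, gammaMono_append]
      have hs : sgn p i = 1 ∨ sgn p i = -1 := by unfold sgn; split_ifs <;> simp
      rw [key]
      rcases ih (β ++ δ).length (by simp at hN ⊢; omega) hw hpar rfl with h' | h' <;>
        rcases neg_one_pow_eq_or ℝ (β.length + β.count i) with h | h <;>
        rcases hs with hs | hs <;> rw [h, h', hs] <;> simp

lemma gammaMono_of_par_eq {α β : List ℕ} (hα : IsWord (p + q) α) (hβ : IsWord (p + q) β)
    (h : par α = par β) : gammaMono p q α = gammaMono p q β ∨
      gammaMono p q α = -gammaMono p q β := by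
  have h0 : par (α ++ β) = 0 := by
    rw [par_append, h]; ext i; exact CharTwo.add_self_eq_zero (par β i)
  have h1 := gammaMono_of_par_eq_zero (isWord_append.2 ⟨hα, hβ⟩) h0
  rw [gammaMono_append] at h1
  have h2 : ∀ s : Cl p q, gammaMono p q α * gammaMono p q β = s →
      gammaMono p q α * (gammaMono p q β * gammaMono p q β) = s * gammaMono p q β := by
    rintro s rfl; rw [mul_assoc]
  rcases h1 with h1 | h1 <;> have h3 := h2 _ h1 <;>
    rcases gammaMono_mul_self hβ with h4 | h4 <;> rw [h4] at h3
  · left; simpa using h3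
  · right; rw [← neg_eq_iff_eq_neg]; simpa using h3
  · right; simpa using h3
  · left; simpa using h3

/-! ### The positive anti-automorphism -/

/-- The isometry multiplying each coordinate vector by its square. -/
def signIsometry (p q : ℕ) : quadForm p q →qᵢ quadForm p q where
  toFun v j := sgn p (j + 1) * v j
  map_add' v w := by ext; simp [mul_add]
  map_smul' c v := by ext; simp; ring
  map_app' v := by
    simp only [quadForm, QuadraticMap.weightedSumSquares_apply]
    refine Finset.sum_congr rfl fun j _ => ?_
    congr 1
    linear_combination (v j * v j) * sgn_mul_self (p := p) (j + 1)

/-- The positive anti-automorphism of `Cl_{p,q}`: it inverts each generator and reverses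
products. -/
def conj : Cl p q →ₗ[ℝ] Cl p q :=
  CliffordAlgebra.reverse ∘ₗ (CliffordAlgebra.map (signIsometry p q)).toLinearMap

lemma conj_mul (x y : Cl p q) : conj (x * y) = conj y * conj x := by
  simp [conj, CliffordAlgebra.reverse.map_mul]

lemma conj_one : conj (1 : Cl p q) = 1 := by
  simp [conj]

lemma conj_gamma (i : ℕ) : conj (gamma p q i) = sgn p i • gamma p q i := by
  simp only [conj, LinearMap.comp_apply, AlgHom.toLinearMap_apply, gamma,
    CliffordAlgebra.map_apply_ι, CliffordAlgebra.reverse_ι, ← map_smul]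
  congr 1
  ext j
  change sgn p (j + 1) * (if (j : ℕ) + 1 = i then 1 else 0) = _
  by_cases h : (j : ℕ) + 1 = i <;> simp [h]

lemma conj_gammaMono_mul_self {α : List ℕ} (hα : IsWord (p + q) α) :
    conj (gammaMono p q α) * gammaMono p q α = 1 := by
  induction α with
  | nil => simp [conj_one]
  | cons i α ih =>
    rw [isWord_cons] at hα
    rw [gammaMono_cons, conj_mul, conj_gamma, mul_assoc, ← mul_assoc (_ • _), smul_mul_assoc,
      gamma_mul_self hα.1.1 hα.1.2, smul_smul, sgn_mul_self, one_smul, one_mul, ih hα.2]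

/-- Since `conj` inverts monomials, it fixes those of square 1 and negates those of square -1. -/
lemma conj_gammaMono_of_sq_eq {α : List ℕ} (hα : IsWord (p + q) α) {s : Cl p q}
    (h : gammaMono p q α * gammaMono p q α = s) (hs : s = 1 ∨ s = -1) :
    conj (gammaMono p q α) = s * gammaMono p q α := by
  have h1 := conj_gammaMono_mul_self hα
  have h2 : conj (gammaMono p q α) * s = gammaMono p q α := by
    rw [← h, ← mul_assoc, h1, one_mul]
  rcases hs with rfl | rfl
  · simpa using h2
  · rw [neg_one_mul, ← neg_eq_iff_eq_neg]; simpa using h2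

lemma conj_conj (x : Cl p q) : conj (conj x) = x := by
  induction x using CliffordAlgebra.induction with
  | algebraMap r => rw [Algebra.algebraMap_eq_smul_one, map_smul, conj_one, map_smul, conj_one]
  | ι v =>
    simp only [conj, LinearMap.comp_apply, AlgHom.toLinearMap_apply,
      CliffordAlgebra.map_apply_ι, CliffordAlgebra.reverse_ι]
    congr 1
    ext j
    change sgn p (j + 1) * (sgn p (j + 1) * v j) = v j
    rw [← mul_assoc, sgn_mul_self, one_mul]
  | mul a b ha hb => rw [conj_mul, conj_mul, ha, hb]
  | add a b ha hb => rw [map_add, map_add, ha, hb]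

/-! ### Spanning by monomials -/

lemma span_gammaMono :
    Submodule.span ℝ {x : Cl p q | ∃ α, IsWord (p + q) α ∧ gammaMono p q α = x} = ⊤ := by
  set W := Submodule.span ℝ {x : Cl p q | ∃ α, IsWord (p + q) α ∧ gammaMono p q α = x}
  have hW : ∀ α, IsWord (p + q) α → gammaMono p q α ∈ W :=
    fun α h => Submodule.subset_span ⟨α, h, rfl⟩
  rw [eq_top_iff]
  rintro x -
  induction x using CliffordAlgebra.induction with
  | algebraMap r =>
    rw [Algebra.algebraMap_eq_smul_one]
    exact W.smul_mem _ (hW [] (isWord_nil _))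
  | ι v =>
    have hv : v = ∑ j, v j •
        (fun k : Fin (p + q) => if (k : ℕ) + 1 = (j : ℕ) + 1 then (1 : ℝ) else 0) := by
      ext k
      simp [Finset.sum_apply, Fin.val_inj]
    rw [hv, map_sum]
    refine W.sum_mem fun j _ => ?_
    rw [map_smul]
    refine W.smul_mem _ ?_
    have := hW [(j : ℕ) + 1] (by simp only [IsWord, List.mem_singleton]; grind)
    simpa [gammaMono, gamma] using this
  | mul a b ha hb =>
    induction ha using Submodule.span_induction with
    | mem x hx =>
      obtain ⟨α, hα, rfl⟩ := hx
      induction hb using Submodule.span_induction with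
      | mem y hy =>
        obtain ⟨β, hβ, rfl⟩ := hy
        rw [← gammaMono_append]
        exact hW _ (isWord_append.2 ⟨hα, hβ⟩)
      | zero => simp
      | add y z _ _ hy hz => rw [mul_add]; exact W.add_mem hy hz
      | smul c y _ hy => rw [mul_smul_comm]; exact W.smul_mem c hy
    | zero => simp
    | add y z _ _ hy hz => rw [add_mul]; exact W.add_mem hy hz
    | smul c y _ hy => rw [smul_mul_assoc]; exact W.smul_mem c hy
  | add a b ha hb => exact W.add_mem ha hb

lemma par_toList (S : Finset ℕ) (i : ℕ) : par S.toList i = if i ∈ S then 1 else 0 := by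
  split_ifs with h
  · rw [par, List.count_eq_one_of_mem S.nodup_toList (by simpa using h), Nat.cast_one]
  · rw [par, List.count_eq_zero_of_not_mem (by simpa using h), Nat.cast_zero]

lemma isWord_toList {n : ℕ} {S : Finset ℕ} (h : S ⊆ Finset.Icc 1 n) : IsWord n S.toList := by
  intro i hi
  simpa using h (Finset.mem_toList.1 hi)

lemma par_eq_zero_of_not_mem {α : List ℕ} {i : ℕ} (h : i ∉ α) : par α i = 0 := by
  rw [par, List.count_eq_zero_of_not_mem h, Nat.cast_zero]

lemma exists_finset_par_eq {n : ℕ} {α : List ℕ} (hα : IsWord n α) :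
    ∃ S ⊆ Finset.Icc 1 n, par α = par S.toList := by
  refine ⟨(Finset.Icc 1 n).filter fun i => par α i ≠ 0, Finset.filter_subset _ _, ?_⟩
  ext i
  rw [par_toList]
  have h01 : ∀ x : ZMod 2, x ≠ 0 → x = 1 := by decide
  by_cases h : par α i = 0
  · simp [h]
  · have hi : i ∈ α := by
      by_contra hi
      exact h (par_eq_zero_of_not_mem hi)
    have := hα i hi
    simp [h01 _ h, this]

/-- The basis monomials of `Cl_{p,q}`, up to sign. -/
def monomial (p q : ℕ) (S : (Finset.Icc 1 (p + q)).powerset) : Cl p q :=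
  gammaMono p q S.1.toList

lemma isWord_subset {n : ℕ} (S : (Finset.Icc 1 n).powerset) : IsWord n S.1.toList :=
  isWord_toList (Finset.mem_powerset.1 S.2)

lemma span_range_monomial : Submodule.span ℝ (Set.range (monomial p q)) = ⊤ := by
  rw [eq_top_iff, ← span_gammaMono, Submodule.span_le]
  rintro _ ⟨α, hα, rfl⟩
  obtain ⟨S, hS, hpar⟩ := exists_finset_par_eq hα
  have hmem : gammaMono p q S.toList ∈ Submodule.span ℝ (Set.range (monomial p q)) :=
    Submodule.subset_span ⟨⟨S, Finset.mem_powerset.2 hS⟩, rfl⟩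
  rcases gammaMono_of_par_eq hα (isWord_toList hS) hpar with h | h
  · rw [h]; exact hmem
  · rw [h]; exact Submodule.neg_mem _ hmem

instance : Module.Finite ℝ (Cl p q) :=
  ⟨span_range_monomial (p := p) (q := q) ▸ Submodule.fg_span (Set.finite_range _)⟩

/-! ### Trace, positivity and the dimension of the algebra -/

/-- The trace of right multiplication. -/
def tr : Cl p q →ₗ[ℝ] ℝ := LinearMap.trace ℝ (Cl p q) ∘ₗ (LinearMap.mul ℝ (Cl p q)).flip

lemma tr_apply (x : Cl p q) : tr x = LinearMap.trace ℝ (Cl p q) (LinearMap.mulRight ℝ x) := rfl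

lemma tr_one : tr (1 : Cl p q) = Module.finrank ℝ (Cl p q) := by
  rw [tr_apply, LinearMap.mulRight_one, LinearMap.trace_id]

lemma tr_mul_comm (x y : Cl p q) : tr (x * y) = tr (y * x) := by
  rw [tr_apply, tr_apply, LinearMap.mulRight_mul, LinearMap.mulRight_mul]
  exact LinearMap.trace_mul_comm ℝ _ _

/-- The grade involution is an algebra automorphism, so it conjugates right multiplication by `x`
into right multiplication by the image of `x`. -/
lemma tr_involute (x : Cl p q) : tr (CliffordAlgebra.involute x) = tr x := by
  rw [tr_apply, tr_apply,
    ← LinearMap.trace_conj' (LinearMap.mulRight ℝ x)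
      (CliffordAlgebra.involuteEquiv (Q := quadForm p q)).toLinearEquiv]
  congr 1
  ext y
  simp [LinearEquiv.conj_apply, CliffordAlgebra.involuteEquiv]

lemma involute_gammaMono (α : List ℕ) :
    CliffordAlgebra.involute (gammaMono p q α) = (-1 : ℝ) ^ α.length • gammaMono p q α := by
  induction α with
  | nil => simp
  | cons i α ih =>
    rw [gammaMono_cons, map_mul, ih, gamma, CliffordAlgebra.involute_ι, mul_smul_comm, neg_mul,
      List.length_cons, pow_succ, mul_neg_one, neg_smul, smul_neg]

/-- A word of odd length is negated by the grade involution. A word of even length is negated by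
conjugation with a letter of odd multiplicity. Both operations preserve the trace. -/
lemma tr_gammaMono_eq_zero {α : List ℕ} (hα : IsWord (p + q) α) (h : par α ≠ 0) :
    tr (gammaMono p q α) = 0 := by
  rcases Nat.even_or_odd α.length with he | ho
  · obtain ⟨i, hi⟩ := Function.ne_iff.1 h
    have hmem : i ∈ α := by
      by_contra hmem
      exact hi (par_eq_zero_of_not_mem hmem)
    have hodd : Odd (α.count i) := by
      rwa [← ZMod.natCast_ne_zero_iff_odd]
    have hanti := gamma_mul_gammaMono (p := p) (q := q) i α
    rw [(he.add_odd hodd).neg_one_pow, neg_one_smul] at hanti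
    obtain ⟨u, hu⟩ : IsUnit (gamma p q i) := by
      simpa using isUnit_gammaMono (p := p) (q := q) (α := [i])
        (isWord_cons.2 ⟨hα i hmem, isWord_nil _⟩)
    rw [← hu] at hanti
    have h1 : tr (gammaMono p q α) = tr ((u : Cl p q) * gammaMono p q α * (↑u⁻¹ : Cl p q)) := by
      rw [tr_mul_comm, ← mul_assoc, Units.inv_mul, one_mul]
    rw [hanti, neg_mul, map_neg, mul_assoc, Units.mul_inv, mul_one] at h1
    linarith
  · have h1 := tr_involute (gammaMono p q α)
    rw [involute_gammaMono, ho.neg_one_pow, neg_one_smul, map_neg] at h1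
    linarith

lemma finrank_pos : 0 < (Module.finrank ℝ (Cl p q) : ℝ) :=
  Nat.cast_pos.2 Module.finrank_pos

/-- For `S ≠ T` the product is, up to sign, a word whose parity is the nonzero symmetric difference,
so the monomials are orthogonal. -/
lemma tr_conj_monomial_mul_monomial (S T : (Finset.Icc 1 (p + q)).powerset) :
    tr (conj (monomial p q S) * monomial p q T) =
      if S = T then (Module.finrank ℝ (Cl p q) : ℝ) else 0 := by
  split_ifs with h
  · subst h
    rw [monomial, conj_gammaMono_mul_self (isWord_subset S), tr_one]
  · have hne : par (S.1.toList ++ T.1.toList) ≠ 0 := by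
      contrapose! h
      ext i
      have hi := congrFun h i
      rw [par_append, Pi.add_apply, par_toList, par_toList] at hi
      by_cases h1 : i ∈ S.1 <;> by_cases h2 : i ∈ T.1 <;> simp [h1, h2] at hi ⊢
    have h0 := tr_gammaMono_eq_zero (p := p) (q := q)
      (isWord_append.2 ⟨isWord_subset S, isWord_subset T⟩) hne
    rw [gammaMono_append] at h0
    rcases gammaMono_mul_self (p := p) (q := q) (isWord_subset S) with h1 | h1
    · rw [monomial, conj_gammaMono_of_sq_eq (isWord_subset S) h1 (Or.inl rfl), one_mul]
      exact h0
    · rw [monomial, conj_gammaMono_of_sq_eq (isWord_subset S) h1 (Or.inr rfl), neg_one_mul,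
        neg_mul, map_neg, neg_eq_zero]
      exact h0

lemma tr_conj_mul_self_sum (a : (Finset.Icc 1 (p + q)).powerset → ℝ) :
    tr (conj (∑ S, a S • monomial p q S) * ∑ S, a S • monomial p q S) =
      Module.finrank ℝ (Cl p q) * ∑ S, a S ^ 2 := by
  simp only [map_sum, map_smul, Finset.sum_mul, Finset.mul_sum, smul_mul_assoc, mul_smul_comm,
    tr_conj_monomial_mul_monomial, smul_eq_mul, mul_ite, mul_zero,
    Finset.sum_ite_eq', Finset.mem_univ, if_true]
  exact Finset.sum_congr rfl fun S _ => by ring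

/-- The hypothesis is an inequality so that the lemma yields both the positivity of the form and the
linear independence of the monomials. -/
lemma coeff_eq_zero_of_tr {a : (Finset.Icc 1 (p + q)).powerset → ℝ}
    (h : tr (conj (∑ S, a S • monomial p q S) * ∑ S, a S • monomial p q S) ≤ 0) (S) :
    a S = 0 := by
  rw [tr_conj_mul_self_sum] at h
  have h1 : ∑ S, a S ^ 2 ≤ 0 := nonpos_of_mul_nonpos_right h finrank_pos
  have h2 : a S ^ 2 ≤ ∑ S, a S ^ 2 :=
    Finset.single_le_sum (f := fun S => a S ^ 2) (fun S _ => sq_nonneg _) (Finset.mem_univ S)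
  exact pow_eq_zero_iff (two_ne_zero) |>.1 (le_antisymm (h2.trans h1) (sq_nonneg _))

lemma tr_conj_mul_self_pos {x : Cl p q} (hx : x ≠ 0) : 0 < tr (conj x * x) := by
  have hmem : x ∈ Submodule.span ℝ (Set.range (monomial p q)) := by
    rw [span_range_monomial]; trivial
  obtain ⟨a, rfl⟩ := (Submodule.mem_span_range_iff_exists_fun ℝ).1 hmem
  by_contra! h
  exact hx (Finset.sum_eq_zero fun S _ => by rw [coeff_eq_zero_of_tr h S, zero_smul])

lemma finrank_cl : Module.finrank ℝ (Cl p q) = 2 ^ (p + q) := by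
  have hli : LinearIndependent ℝ (monomial p q) := by
    rw [Fintype.linearIndependent_iff]
    intro a ha
    exact coeff_eq_zero_of_tr (by rw [ha]; simp)
  rw [← finrank_top, ← span_range_monomial, finrank_span_eq_card hli]
  simp

/-! ### Commuting involutions and their idempotent -/

/-- Words of `L` yield mutually commuting involutions. -/
structure IsCommutingInvolutive (p q : ℕ) (L : List (List ℕ)) : Prop where
  word : ∀ α ∈ L, IsWord (p + q) α
  sq : ∀ α ∈ L, gammaMono p q α * gammaMono p q α = 1
  comm : ∀ α ∈ L, ∀ β ∈ L, Commute (gammaMono p q α) (gammaMono p q β)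

lemma IsCommutingInvolutive.mono {L M : List (List ℕ)} (h : IsCommutingInvolutive p q L)
    (hM : M ⊆ L) : IsCommutingInvolutive p q M :=
  ⟨fun α hα => h.word α (hM hα), fun α hα => h.sq α (hM hα),
    fun α hα β hβ => h.comm α (hM hα) β (hM hβ)⟩

/-- Each word contains exactly once some letter that is absent from all later words. -/
def Triangular : List (List ℕ) → Prop
  | [] => True
  | α :: L => (∃ i, α.count i = 1 ∧ ∀ β ∈ L, i ∉ β) ∧ Triangular L

lemma Triangular.nodup {L : List (List ℕ)} (h : Triangular L) : L.Nodup := by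
  induction L with
  | nil => simp
  | cons α L ih =>
    obtain ⟨⟨i, hi, hL⟩, h⟩ := h
    refine List.nodup_cons.2 ⟨fun hα => hL α hα ?_, ih h⟩
    exact List.count_pos_iff.1 (by omega)

lemma Triangular.sublist {L M : List (List ℕ)} (h : Triangular L) (hM : M.Sublist L) :
    Triangular M := by
  induction hM with
  | slnil => trivial
  | cons α _ ih => exact ih h.2
  | cons_cons α hs ih =>
    obtain ⟨⟨i, hi, hL⟩, h⟩ := h
    exact ⟨⟨i, hi, fun β hβ => hL β (hs.subset hβ)⟩, ih h⟩

lemma Triangular.append {L M : List (List ℕ)} (hL : Triangular L) (hM : Triangular M)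
    (h : ∀ α ∈ L, ∀ β ∈ M, ∀ i ∈ α, i ∉ β) : Triangular (L ++ M) := by
  induction L with
  | nil => exact hM
  | cons α L ih =>
    obtain ⟨⟨i, hi, hd⟩, hL⟩ := hL
    refine ⟨⟨i, hi, fun β hβ => ?_⟩, ih hL fun γ hγ => h γ (List.mem_cons_of_mem _ hγ)⟩
    rcases List.mem_append.1 hβ with hβ | hβ
    · exact hd β hβ
    · exact h α List.mem_cons_self β hβ i (List.count_pos_iff.1 (by omega))

lemma idem_cons (α : List ℕ) (L : List (List ℕ)) :
    idem p q (α :: L) = (1 / 2 : ℝ) • (idem p q L + gammaMono p q α * idem p q L) := by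
  simp [idem, add_mul]

lemma commute_idem {x : Cl p q} {L : List (List ℕ)}
    (h : ∀ α ∈ L, Commute x (gammaMono p q α)) : Commute x (idem p q L) := by
  refine Commute.list_prod_right _ _ fun y hy => ?_
  obtain ⟨α, hα, rfl⟩ := List.mem_map.1 hy
  exact ((Commute.one_right x).add_right (h α hα)).smul_right _

lemma idem_mul_of_fixed {y : Cl p q} {L : List (List ℕ)}
    (h : ∀ α ∈ L, gammaMono p q α * y = y) : idem p q L * y = y := by
  induction L with
  | nil => simp [idem]
  | cons α L ih =>
    have ih' := ih fun β hβ => h β (List.mem_cons_of_mem _ hβ)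
    rw [idem_cons, smul_mul_assoc, add_mul, mul_assoc, ih', h α List.mem_cons_self, ← two_smul ℝ,
      smul_smul]
    norm_num

namespace IsCommutingInvolutive

variable {L : List (List ℕ)}

lemma gammaMono_mul_idem (h : IsCommutingInvolutive p q L) {α : List ℕ} (hα : α ∈ L) :
    gammaMono p q α * idem p q L = idem p q L := by
  induction L with
  | nil => simp at hα
  | cons β L ih =>
    rw [idem_cons, mul_smul_comm, mul_add, ← mul_assoc]
    rcases List.mem_cons.1 hα with rfl | hα'
    · rw [h.sq α hα, one_mul, add_comm (idem p q L)]
    · have ih' := ih (h.mono (List.subset_cons_self _ _)) hα'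
      rw [(h.comm α hα β List.mem_cons_self).eq, mul_assoc, ih']

lemma idem_mul_gammaMono (h : IsCommutingInvolutive p q L) {α : List ℕ} (hα : α ∈ L) :
    idem p q L * gammaMono p q α = idem p q L := by
  rw [← (commute_idem fun β hβ => h.comm α hα β hβ).eq, h.gammaMono_mul_idem hα]

lemma idem_mul_idem (h : IsCommutingInvolutive p q L) :
    idem p q L * idem p q L = idem p q L :=
  idem_mul_of_fixed fun _ hα => h.gammaMono_mul_idem hα

lemma conj_idem (h : IsCommutingInvolutive p q L) : conj (idem p q L) = idem p q L := by
  induction L with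
  | nil => simp [idem, conj_one]
  | cons α L ih =>
    have hα : α ∈ α :: L := List.mem_cons_self
    have hcomm : Commute (gammaMono p q α) (idem p q L) :=
      commute_idem fun β hβ => h.comm α hα β (List.mem_cons_of_mem _ hβ)
    rw [idem_cons, map_smul, map_add, conj_mul, ih (h.mono (List.subset_cons_self _ _)),
      conj_gammaMono_of_sq_eq (h.word α hα) (h.sq α hα) (Or.inl rfl), one_mul, hcomm.eq]

lemma idem_perm (h : IsCommutingInvolutive p q L) {M : List (List ℕ)} (hM : L.Perm M) :
    idem p q L = idem p q M := by
  refine (hM.map _).prod_eq' ?_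
  rw [List.pairwise_map]
  refine List.pairwise_of_forall_mem_list fun α hα β hβ => ?_
  exact (((Commute.one_right _).add_right ((Commute.one_left _).add_left
    (h.comm α hα β hβ))).smul_right _).smul_left _

/-- Monomials that do not commute anticommute. As F absorbs γ_α on either side, F γ_β F = F γ_β γ_α
F = -F γ_α γ_β F = -F γ_β F. -/
lemma idem_mul_mul_idem_of_not_commute (h : IsCommutingInvolutive p q L) {α β : List ℕ}
    (hα : α ∈ L) (hn : ¬ Commute (gammaMono p q β) (gammaMono p q α)) :
    idem p q L * gammaMono p q β * idem p q L = 0 := by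
  have hanti : gammaMono p q β * gammaMono p q α = -(gammaMono p q α * gammaMono p q β) := by
    have h1 := gammaMono_mul_gammaMono (p := p) (q := q) β α
    rcases neg_one_pow_eq_or ℝ (β.length * α.length + coincidences β α) with h2 | h2 <;>
      rw [h2] at h1
    · exact absurd (h1.trans (one_smul ℝ _)) hn
    · simpa using h1
  have h1 : idem p q L * gammaMono p q β * idem p q L =
      -(idem p q L * gammaMono p q β * idem p q L) := by
    conv_lhs => rw [← h.gammaMono_mul_idem hα, ← mul_assoc, mul_assoc _ (gammaMono p q β), hanti]
    conv_lhs => rw [h.gammaMono_mul_idem hα, mul_neg, ← mul_assoc, h.idem_mul_gammaMono hα]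
    rw [neg_mul]
  rw [eq_neg_iff_add_eq_zero, ← two_smul ℝ] at h1
  exact (smul_eq_zero.1 h1).resolve_left two_ne_zero

end IsCommutingInvolutive

/-! ### The trace of the idempotent -/

/-- The parity vectors spanned by the words of `L`. -/
def parSpan (L : List (List ℕ)) : Submodule (ZMod 2) (ℕ → ZMod 2) :=
  Submodule.span (ZMod 2) {v | ∃ α ∈ L, par α = v}

lemma par_mem_parSpan {L : List (List ℕ)} {α : List ℕ} (h : α ∈ L) : par α ∈ parSpan L :=
  Submodule.subset_span ⟨α, h, rfl⟩

lemma parSpan_mono {L M : List (List ℕ)} (h : L ⊆ M) : parSpan L ≤ parSpan M :=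
  Submodule.span_mono fun _ ⟨α, hα, hv⟩ => ⟨α, h hα, hv⟩

lemma parSpan_apply_eq_zero {K : List (List ℕ)} {v : ℕ → ZMod 2} (hv : v ∈ parSpan K) {i : ℕ}
    (hi : ∀ α ∈ K, i ∉ α) : v i = 0 := by
  have hle : parSpan K ≤ LinearMap.ker (LinearMap.proj (R := ZMod 2) (φ := fun _ => ZMod 2) i) := by
    refine Submodule.span_le.2 ?_
    rintro _ ⟨β, hβ, rfl⟩
    exact par_eq_zero_of_not_mem (hi β hβ)
  exact hle hv

/-- Every word in the expansion has parity in the coset of `par β` modulo `parSpan L`, which does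
not contain zero. -/
lemma tr_gammaMono_mul_idem {L : List (List ℕ)} (hL : ∀ α ∈ L, IsWord (p + q) α) {β : List ℕ}
    (hβ : IsWord (p + q) β) (h : par β ∉ parSpan L) : tr (gammaMono p q β * idem p q L) = 0 := by
  induction L generalizing β with
  | nil =>
    rw [show idem p q [] = 1 from rfl, mul_one]
    refine tr_gammaMono_eq_zero hβ fun h0 => h ?_
    rw [h0]
    exact Submodule.zero_mem _
  | cons α L ih =>
    have hsub := parSpan_mono (List.subset_cons_self α L)
    have hL' : ∀ α ∈ L, IsWord (p + q) α := fun γ hγ => hL γ (List.mem_cons_of_mem _ hγ)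
    have h1 := ih hL' hβ fun hm => h (hsub hm)
    have h2 := ih hL' (isWord_append.2 ⟨hβ, hL α List.mem_cons_self⟩) fun hm => h <| by
      rw [par_append] at hm
      exact (Submodule.add_mem_iff_left _ (par_mem_parSpan List.mem_cons_self)).1 (hsub hm)
    rw [gammaMono_append, mul_assoc] at h2
    rw [idem_cons, mul_smul_comm, mul_add, map_smul, map_add, h1, h2]
    simp

/-- The letter private to `α` puts `par α` outside the span of the later words, so each new factor
just halves the trace. -/
lemma tr_idem {L : List (List ℕ)} (hL : ∀ α ∈ L, IsWord (p + q) α) (ht : Triangular L) :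
    tr (idem p q L) = 2 ^ (p + q) / 2 ^ L.length := by
  induction L with
  | nil =>
    rw [show idem p q [] = 1 from rfl, tr_one, finrank_cl]
    simp
  | cons α L ih =>
    obtain ⟨⟨i, hi, hd⟩, ht⟩ := ht
    have hL' : ∀ α ∈ L, IsWord (p + q) α := fun γ hγ => hL γ (List.mem_cons_of_mem _ hγ)
    have hnot : par α ∉ parSpan L := by
      intro hm
      have h0 : par α i = 0 := parSpan_apply_eq_zero hm hd
      rw [par, hi, Nat.cast_one] at h0
      exact one_ne_zero h0
    rw [idem_cons, map_smul, map_add, tr_gammaMono_mul_idem hL' (hL α List.mem_cons_self) hnot,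
      ih hL' ht, List.length_cons, smul_eq_mul]
    field_simp
    ring

/-! ### Independence, primitivity, minimality and dimension -/

/-- Every monomial commuting with the words of `L` and squaring to `1` acts on the associated
idempotent as a sign. -/
def IsMaximal (p q : ℕ) (L : List (List ℕ)) : Prop :=
  ∀ β, IsWord (p + q) β → (∀ α ∈ L, Commute (gammaMono p q β) (gammaMono p q α)) →
    gammaMono p q β * gammaMono p q β = 1 →
    gammaMono p q β * idem p q L = idem p q L ∨ gammaMono p q β * idem p q L = -idem p q L

namespace IsCommutingInvolutive

variable {L : List (List ℕ)}

/-- If `α` fixed the idempotent of the other words, that idempotent would equal the full one,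
although their traces differ by a factor of two. -/
lemma gammaMono_mul_idem_erase_ne (h : IsCommutingInvolutive p q L) (ht : Triangular L)
    {α : List ℕ} (hα : α ∈ L) :
    gammaMono p q α * idem p q (L.erase α) ≠ idem p q (L.erase α) := by
  intro hfix
  have h1 := tr_idem (p := p) (q := q) h.word ht
  have h2 := tr_idem (p := p) (q := q) (L := L.erase α)
    (fun β hβ => h.word β (List.mem_of_mem_erase hβ))
    (ht.sublist List.erase_sublist)
  have hpos : 0 < L.length := List.length_pos_of_mem hα
  rw [h.idem_perm (List.perm_cons_erase hα), idem_cons, hfix, ← two_smul ℝ, smul_smul,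
    show (1 / 2 : ℝ) * 2 = 1 by norm_num, one_smul, h2, List.length_erase_of_mem hα] at h1
  obtain ⟨k, hk⟩ : ∃ k, L.length = k + 1 := ⟨L.length - 1, by omega⟩
  rw [hk, Nat.add_sub_cancel, div_eq_div_iff (by positivity) (by positivity), pow_succ] at h1
  have : (0 : ℝ) < 2 ^ (p + q) * 2 ^ k := by positivity
  nlinarith

lemma mul_idem_erase_of_mem_closure (h : IsCommutingInvolutive p q L) {α : List ℕ}
    {x : Cl p q} (hx : x ∈ Submonoid.closure (gammaSet p q L \ {gammaMono p q α})) :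
    x * idem p q (L.erase α) = idem p q (L.erase α) := by
  induction hx using Submonoid.closure_induction with
  | mem x hx =>
    obtain ⟨⟨β, hβ, rfl⟩, hne⟩ := hx
    refine (h.mono List.erase_subset).gammaMono_mul_idem ?_
    exact (List.mem_erase_of_ne fun he => hne (by rw [he]; rfl)).2 hβ
  | one => exact one_mul _
  | mul x y _ _ hx hy => rw [mul_assoc, hy, hx]

lemma notMem_closure (h : IsCommutingInvolutive p q L) (ht : Triangular L) {g : Cl p q}
    (hg : g ∈ gammaSet p q L) : g ∉ Submonoid.closure (gammaSet p q L \ {g}) := by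
  obtain ⟨α, hα, rfl⟩ := hg
  exact fun hm => h.gammaMono_mul_idem_erase_ne ht hα (h.mul_idem_erase_of_mem_closure hm)

lemma finite_gammaSet (L : List (List ℕ)) : (gammaSet p q L).Finite :=
  (L.toFinset.finite_toSet.image (gammaMono p q)).subset fun _ ⟨α, hα, hg⟩ =>
    ⟨α, by simpa using hα, hg⟩

lemma ncard_gammaSet (h : IsCommutingInvolutive p q L) (ht : Triangular L) :
    (gammaSet p q L).ncard = L.length := by
  have himg : gammaSet p q L = gammaMono p q '' (L.toFinset : Set (List ℕ)) := by
    ext g; simp [gammaSet]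
  rw [himg, Set.InjOn.ncard_image, Set.ncard_coe_finset, List.toFinset_card_of_nodup ht.nodup]
  intro α hα β hβ hαβ
  rw [Finset.mem_coe, List.mem_toFinset] at hα hβ
  by_contra hne
  refine h.gammaMono_mul_idem_erase_ne ht hα ?_
  rw [hαβ]
  exact (h.mono List.erase_subset).gammaMono_mul_idem ((List.mem_erase_of_ne (Ne.symm hne)).2 hβ)

lemma idem_ne_zero (h : IsCommutingInvolutive p q L) (ht : Triangular L) : idem p q L ≠ 0 := by
  intro h0
  have h1 := tr_idem (p := p) (q := q) h.word ht
  rw [h0, map_zero] at h1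
  exact absurd h1.symm (by positivity)

/-- Only symmetric elements can be compressed to scalars: F Cl F may be larger than ℝF, but
symmetrizing removes the monomials of square -1. -/
lemma idem_mul_symm_mul_idem (h : IsCommutingInvolutive p q L) (hm : IsMaximal p q L)
    (y : Cl p q) :
    idem p q L * (y + conj y) * idem p q L ∈ Submodule.span ℝ {idem p q L} := by
  have hy : y ∈ Submodule.span ℝ {x : Cl p q | ∃ α, IsWord (p + q) α ∧ gammaMono p q α = x} := by
    rw [span_gammaMono]; trivial
  induction hy using Submodule.span_induction with
  | mem x hx =>
    obtain ⟨β, hβ, rfl⟩ := hx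
    rcases gammaMono_mul_self hβ with hs | hs
    · rw [conj_gammaMono_of_sq_eq hβ hs (Or.inl rfl), one_mul, mul_add, add_mul]
      suffices idem p q L * gammaMono p q β * idem p q L ∈ Submodule.span ℝ {idem p q L} from
        Submodule.add_mem _ this this
      by_cases hc : ∀ α ∈ L, Commute (gammaMono p q β) (gammaMono p q α)
      · rw [mul_assoc]
        rcases hm β hβ hc hs with h1 | h1
        · rw [h1, h.idem_mul_idem]
          exact Submodule.mem_span_singleton_self _
        · rw [h1, mul_neg, h.idem_mul_idem]
          exact Submodule.neg_mem _ (Submodule.mem_span_singleton_self _)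
      · push Not at hc
        obtain ⟨α, hα, hn⟩ := hc
        rw [h.idem_mul_mul_idem_of_not_commute hα hn]
        exact Submodule.zero_mem _
    · rw [conj_gammaMono_of_sq_eq hβ hs (Or.inr rfl)]
      simp
  | zero => simp
  | add y z _ _ hy hz =>
    rw [map_add, add_add_add_comm, mul_add, add_mul]
    exact Submodule.add_mem _ hy hz
  | smul c y _ hy =>
    rw [map_smul, ← smul_add, mul_smul_comm, smul_mul_assoc]
    exact Submodule.smul_mem _ c hy

/-- The element conj x * x is symmetric and fixed by F on both sides, hence a multiple of F;
positivity of its trace makes the multiple nonzero. -/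
lemma exists_mul_eq_idem (h : IsCommutingInvolutive p q L) (hm : IsMaximal p q L)
    {x : Cl p q} (hx : x ≠ 0) (hxF : x * idem p q L = x) : ∃ z, z * x = idem p q L := by
  have hF : idem p q L * (conj x * x) * idem p q L = conj x * x := by
    have h1 : idem p q L * conj x = conj x := by
      conv_lhs => rw [← h.conj_idem, ← conj_mul, hxF]
    rw [← mul_assoc, h1, mul_assoc, hxF]
  have hsymm : conj (conj x * x) = conj x * x := by rw [conj_mul, conj_conj]
  have h1 := h.idem_mul_symm_mul_idem hm (conj x * x)
  rw [hsymm, mul_add, add_mul, hF, ← two_smul ℝ] at h1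
  obtain ⟨c, hc⟩ := Submodule.mem_span_singleton.1 h1
  have hc0 : c ≠ 0 := by
    rintro rfl
    have hpos := tr_conj_mul_self_pos hx
    rw [zero_smul] at hc
    rw [(smul_eq_zero.1 hc.symm).resolve_left two_ne_zero, map_zero] at hpos
    exact lt_irrefl _ hpos
  refine ⟨(c⁻¹ * 2) • conj x, ?_⟩
  rw [smul_mul_assoc, mul_smul, ← hc, smul_smul, inv_mul_cancel₀ hc0, one_smul]

lemma isPrimitiveIdempotent (h : IsCommutingInvolutive p q L) (ht : Triangular L)
    (hm : IsMaximal p q L) : IsPrimitiveIdempotent (idem p q L) := by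
  refine ⟨h.idem_ne_zero ht, h.idem_mul_idem, fun e f he hf hef hfe hsum => ?_⟩
  by_cases h0 : e = 0
  · exact Or.inl h0
  right
  obtain ⟨z, hz⟩ := h.exists_mul_eq_idem hm h0 (by rw [← hsum, mul_add, he, hef, add_zero])
  have hFf : idem p q L * f = f := by rw [← hsum, add_mul, hef, hf, zero_add]
  rw [← hFf, ← hz, mul_assoc, hef, mul_zero]

lemma mem_leftIdeal_iff (h : IsCommutingInvolutive p q L) {x : Cl p q} :
    x ∈ leftIdeal (idem p q L) ↔ x * idem p q L = x := by
  rw [leftIdeal, Ideal.mem_span_singleton']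
  constructor
  · rintro ⟨y, rfl⟩
    rw [mul_assoc, h.idem_mul_idem]
  · exact fun hx => ⟨x, hx⟩

lemma isAtom_leftIdeal (h : IsCommutingInvolutive p q L) (ht : Triangular L)
    (hm : IsMaximal p q L) : IsAtom (leftIdeal (idem p q L)) := by
  constructor
  · rw [leftIdeal, Ne, Ideal.span_singleton_eq_bot]
    exact h.idem_ne_zero ht
  · intro I hI
    by_contra hne
    obtain ⟨x, hxI, hx⟩ := Submodule.exists_mem_ne_zero_of_ne_bot hne
    obtain ⟨z, hz⟩ := h.exists_mul_eq_idem hm hx (h.mem_leftIdeal_iff.1 (hI.le hxI))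
    refine hI.not_ge ?_
    rw [leftIdeal, Ideal.span_singleton_le_iff_mem, ← hz]
    exact I.mul_mem_left z hxI

/-- Right multiplication by F is a projection onto the ideal, and the trace of a projection is its
rank. -/
lemma finrank_leftIdeal (h : IsCommutingInvolutive p q L) (ht : Triangular L) :
    (Module.finrank ℝ (leftIdeal (idem p q L)) : ℝ) = 2 ^ (p + q) / 2 ^ L.length := by
  have hproj : LinearMap.IsProj ((leftIdeal (idem p q L)).restrictScalars ℝ)
      (LinearMap.mulRight ℝ (idem p q L)) :=
    ⟨fun x => Ideal.mul_mem_left _ x (Ideal.mem_span_singleton_self _),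
      fun x hx => h.mem_leftIdeal_iff.1 hx⟩
  rw [← tr_idem h.word ht, tr_apply, hproj.trace]
  rfl

lemma length_le (h : IsCommutingInvolutive p q L) (ht : Triangular L) :
    L.length ≤ p + q := by
  have hF := h.finrank_leftIdeal ht
  have hne : (Module.finrank ℝ (leftIdeal (idem p q L)) : ℝ) ≠ 0 := by
    rw [hF]; positivity
  have h1 : (1 : ℝ) ≤ Module.finrank ℝ (leftIdeal (idem p q L)) := by
    exact_mod_cast Nat.one_le_iff_ne_zero.2 (by exact_mod_cast hne)
  rw [hF, one_le_div (by positivity)] at h1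
  exact (pow_le_pow_iff_right₀ (by norm_num)).1 h1

lemma finrank_leftIdeal_eq (h : IsCommutingInvolutive p q L) (ht : Triangular L) :
    Module.finrank ℝ (leftIdeal (idem p q L)) = 2 ^ (p + q - L.length) := by
  have hF := h.finrank_leftIdeal ht
  rw [div_eq_mul_inv, ← pow_sub₀ _ two_ne_zero (h.length_le ht)] at hF
  exact_mod_cast hF

lemma isGeneratingSet (h : IsCommutingInvolutive p q L) (ht : Triangular L)
    (hcard : (L.length : ℤ) = (q : ℤ) - radonHurwitz ((q : ℤ) - (p : ℤ))) :
    IsGeneratingSet p q (gammaSet p q L) where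
  finite := finite_gammaSet L
  card := by rw [h.ncard_gammaSet ht, hcard]
  involution := by rintro _ ⟨α, hα, rfl⟩; exact h.sq α hα
  commute := by rintro _ ⟨α, hα, rfl⟩ _ ⟨β, hβ, rfl⟩; exact h.comm α hα β hβ
  independent := fun _ hg => h.notMem_closure ht hg

end IsCommutingInvolutive

/-! ### Commutation as a parity condition; translated words -/

lemma neg_one_ne_one : (-1 : Cl p q) ≠ 1 := by
  intro h
  have h1 : (1 : Cl p q) + 1 = 0 := by nth_rewrite 1 [← h]; exact neg_add_cancel _
  rw [← two_smul ℝ (1 : Cl p q)] at h1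
  exact one_ne_zero ((smul_eq_zero.1 h1).resolve_left two_ne_zero)

lemma commute_gammaMono_iff {α β : List ℕ} (hα : IsWord (p + q) α) (hβ : IsWord (p + q) β) :
    Commute (gammaMono p q α) (gammaMono p q β) ↔
      Even (α.length * β.length + coincidences α β) := by
  have h := gammaMono_mul_gammaMono (p := p) (q := q) α β
  constructor
  · intro hc
    by_contra ho
    rw [Nat.not_even_iff_odd] at ho
    rw [ho.neg_one_pow, neg_one_smul, ← hc.eq] at h
    have hu := (isUnit_gammaMono hα).mul (isUnit_gammaMono hβ)
    refine neg_one_ne_one (p := p) (q := q) (hu.mul_left_inj.1 ?_)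
    rw [neg_one_mul, one_mul, ← h]
  · intro he
    rw [he.neg_one_pow, one_smul] at h
    exact h

/-- Translation of a word by `m`. -/
def shift (m : ℕ) (α : List ℕ) : List ℕ := α.map (m + ·)

@[simp] lemma length_shift (m : ℕ) (α : List ℕ) : (shift m α).length = α.length := by simp [shift]

lemma count_shift (m : ℕ) (α : List ℕ) (j : ℕ) : (shift m α).count (m + j) = α.count j :=
  List.count_map_of_injective α _ (add_right_injective m) j

lemma mem_shift {m i : ℕ} {α : List ℕ} : i ∈ shift m α ↔ ∃ j ∈ α, m + j = i := by
  simp [shift]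

lemma coincidences_shift (m : ℕ) (α β : List ℕ) :
    coincidences (shift m α) (shift m β) = coincidences α β := by
  rw [coincidences, coincidences, show (shift m α).map (fun i => (shift m β).count i) =
    α.map (fun i => (shift m β).count (m + i)) from List.map_map]
  simp only [count_shift]

lemma shift_flatten (m : ℕ) (T : List (List ℕ)) :
    (T.map (shift m)).flatten = shift m T.flatten := by
  rw [shift, List.map_flatten]
  rfl

lemma coincidences_eq_zero {α β : List ℕ} (h : ∀ i ∈ α, i ∉ β) : coincidences α β = 0 := by
  rw [coincidences, List.sum_eq_zero_iff]
  intro x hx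
  obtain ⟨i, hi, rfl⟩ := List.mem_map.1 hx
  exact List.count_eq_zero_of_not_mem (h i hi)

/-- The words of `L` overlap so that the corresponding monomials commute. -/
def EvenOverlap (L : List (List ℕ)) : Prop :=
  ∀ α ∈ L, ∀ β ∈ L, (α.length * β.length + coincidences α β) % 2 = 0

lemma EvenOverlap.append {L M : List (List ℕ)} (hL : EvenOverlap L) (hM : EvenOverlap M)
    (he : ∀ α ∈ L, α.length % 2 = 0) (hd : ∀ α ∈ L, ∀ β ∈ M, ∀ i ∈ α, i ∉ β) :
    EvenOverlap (L ++ M) := by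
  intro α hα β hβ
  rcases List.mem_append.1 hα with hα | hα <;> rcases List.mem_append.1 hβ with hβ | hβ
  · exact hL α hα β hβ
  · rw [coincidences_eq_zero (hd α hα β hβ), add_zero, Nat.mul_mod, he α hα, zero_mul, Nat.zero_mod]
  · rw [coincidences_eq_zero fun i hi hi' => hd β hβ α hα i hi' hi, add_zero, Nat.mul_mod,
      he β hβ, mul_zero, Nat.zero_mod]
  · exact hM α hα β hβ

lemma EvenOverlap.map_shift {L : List (List ℕ)} (hL : EvenOverlap L) (m : ℕ) :
    EvenOverlap (L.map (shift m)) := by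
  intro α hα β hβ
  obtain ⟨α, hα', rfl⟩ := List.mem_map.1 hα
  obtain ⟨β, hβ', rfl⟩ := List.mem_map.1 hβ
  rw [length_shift, length_shift, coincidences_shift]
  exact hL α hα' β hβ'

lemma Triangular.map_shift {L : List (List ℕ)} (hL : Triangular L) (m : ℕ) :
    Triangular (L.map (shift m)) := by
  induction L with
  | nil => trivial
  | cons α L ih =>
    obtain ⟨⟨i, hi, hd⟩, hL⟩ := hL
    refine ⟨⟨m + i, by rw [count_shift, hi], fun β hβ hmem => ?_⟩, ih hL⟩
    obtain ⟨β, hβ', rfl⟩ := List.mem_map.1 hβ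
    obtain ⟨j, hj, hji⟩ := mem_shift.1 hmem
    obtain rfl : j = i := by omega
    exact hd β hβ' hj

/-! ### Self-dual binary blocks -/

/-- On `U`, every vector orthogonal to the words of `K` is spanned by them. -/
def SelfDual (K : List (List ℕ)) (U : Set ℕ) : Prop :=
  ∀ x : ℕ → ZMod 2, (∀ α ∈ K, (α.map x).sum = 0) → ∃ v ∈ parSpan K, ∀ i ∈ U, x i = v i

/-- A set of words of even length in the letters `U` whose parity vectors are a basis of a
self-dual binary code. -/
structure EvenBlock (K : List (List ℕ)) (U : Set ℕ) : Prop where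
  even : ∀ α ∈ K, α.length % 2 = 0
  supp : ∀ α ∈ K, ∀ i ∈ α, i ∈ U
  overlap : EvenOverlap K
  triangular : Triangular K
  dual : SelfDual K U

lemma EvenBlock.nil : EvenBlock [] ∅ :=
  ⟨by simp, by simp, by simp [EvenOverlap], trivial, fun _ _ => ⟨0, Submodule.zero_mem _, by simp⟩⟩

lemma EvenBlock.append {K M : List (List ℕ)} {U V : Set ℕ} (hK : EvenBlock K U)
    (hM : EvenBlock M V) (hUV : Disjoint U V) : EvenBlock (K ++ M) (U ∪ V) := by
  have hd : ∀ α ∈ K, ∀ β ∈ M, ∀ i ∈ α, i ∉ β := fun α hα β hβ i hi hi' =>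
    Set.disjoint_left.1 hUV (hK.supp α hα i hi) (hM.supp β hβ i hi')
  refine ⟨?_, ?_, hK.overlap.append hM.overlap hK.even hd,
    hK.triangular.append hM.triangular hd, ?_⟩
  · intro α hα
    exact (List.mem_append.1 hα).elim (hK.even α) (hM.even α)
  · intro α hα i hi
    exact (List.mem_append.1 hα).imp (hK.supp α · i hi) (hM.supp α · i hi)
  · intro x hx
    obtain ⟨v, hv, hvx⟩ := hK.dual x fun α hα => hx α (List.mem_append_left _ hα)
    obtain ⟨w, hw, hwx⟩ := hM.dual x fun α hα => hx α (List.mem_append_right _ hα)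
    refine ⟨v + w, Submodule.add_mem _ (parSpan_mono (List.subset_append_left _ _) hv)
      (parSpan_mono (List.subset_append_right _ _) hw), ?_⟩
    rintro i (hi | hi)
    · rw [Pi.add_apply, ← hvx i hi, parSpan_apply_eq_zero hw fun α hα h =>
        Set.disjoint_left.1 hUV hi (hM.supp α hα i h), add_zero]
    · rw [Pi.add_apply, ← hwx i hi, parSpan_apply_eq_zero hv fun α hα h =>
        Set.disjoint_left.1 hUV (hK.supp α hα i h) hi, zero_add]

lemma EvenBlock.pair {i j : ℕ} (h : i ≠ j) : EvenBlock [[i, j]] {i, j} := by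
  refine ⟨by simp, by simp, ?_, ⟨⟨i, by simp [h.symm], by simp⟩, trivial⟩, ?_⟩
  · simp [EvenOverlap, coincidences, List.count_cons, h, h.symm]
  · intro x hx
    have hij : x i = x j := by
      have := hx [i, j] (by simp)
      simp only [List.map_cons, List.map_nil, List.sum_cons, List.sum_nil, add_zero] at this
      exact CharTwo.add_eq_zero.1 this
    refine ⟨x i • par [i, j], Submodule.smul_mem _ _ (par_mem_parSpan (by simp)), ?_⟩
    rintro k (rfl | rfl)
    · simp [par, h.symm]
    · simp [par, h, hij]

/-- A basis of the extended Hamming code of length eight. -/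
def octet : List (List ℕ) := [[1, 2, 3, 4], [1, 2, 5, 6], [1, 2, 7, 8], [1, 3, 5, 7]]

/-- Letters 4, 6 and 8 each lie in one basis word only, so they give its coefficient. Letter 3 lies
in the first and fourth words, so the fourth coefficient is `x₃ + x₄`. The remaining coordinates
then follow from the parity checks. -/
lemma octet_dual : ∀ x₁ x₂ x₃ x₄ x₅ x₆ x₇ x₈ : ZMod 2,
    x₁ + (x₂ + (x₃ + x₄)) = 0 → x₁ + (x₂ + (x₅ + x₆)) = 0 → x₁ + (x₂ + (x₇ + x₈)) = 0 →
    x₁ + (x₃ + (x₅ + x₇)) = 0 →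
    x₁ = x₄ + x₆ + x₈ + (x₃ + x₄) ∧ x₂ = x₄ + x₆ + x₈ ∧ x₃ = x₄ + (x₃ + x₄) ∧
      x₅ = x₆ + (x₃ + x₄) ∧ x₇ = x₈ + (x₃ + x₄) := by
  decide +kernel

lemma evenBlock_octet (t : ℕ) :
    EvenBlock (octet.map (shift t)) (Set.Icc (t + 1) (t + 8)) := by
  refine ⟨?_, ?_, EvenOverlap.map_shift (by unfold EvenOverlap; decide) t,
    Triangular.map_shift (L := octet)
      ⟨⟨4, by decide⟩, ⟨6, by decide⟩, ⟨8, by decide⟩, ⟨1, by decide⟩, trivial⟩ t, ?_⟩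
  · intro α hα
    obtain ⟨α, hα', rfl⟩ := List.mem_map.1 hα
    rw [length_shift]
    have : ∀ α ∈ octet, α.length % 2 = 0 := by decide
    exact this α hα'
  · intro α hα i hi
    obtain ⟨α, hα', rfl⟩ := List.mem_map.1 hα
    obtain ⟨j, hj, rfl⟩ := mem_shift.1 hi
    have : ∀ α ∈ octet, ∀ j ∈ α, 1 ≤ j ∧ j ≤ 8 := by decide
    have := this α hα' j hj
    exact ⟨by omega, by omega⟩
  · intro x hx
    have h1 := hx (shift t [1, 2, 3, 4]) (List.mem_map_of_mem (by decide))
    have h2 := hx (shift t [1, 2, 5, 6]) (List.mem_map_of_mem (by decide))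
    have h3 := hx (shift t [1, 2, 7, 8]) (List.mem_map_of_mem (by decide))
    have h4 := hx (shift t [1, 3, 5, 7]) (List.mem_map_of_mem (by decide))
    simp only [shift, List.map_cons, List.map_nil, List.sum_cons, List.sum_nil,
      add_zero] at h1 h2 h3 h4
    obtain ⟨e1, e2, e3, e5, e7⟩ := octet_dual _ _ _ _ _ _ _ _ h1 h2 h3 h4
    refine ⟨x (t + 4) • par (shift t [1, 2, 3, 4])
      + x (t + 6) • par (shift t [1, 2, 5, 6])
      + x (t + 8) • par (shift t [1, 2, 7, 8])
      + (x (t + 3) + x (t + 4)) • par (shift t [1, 3, 5, 7]), ?_, ?_⟩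
    · refine Submodule.add_mem _ (Submodule.add_mem _ (Submodule.add_mem _ ?_ ?_) ?_) ?_ <;>
        exact Submodule.smul_mem _ _ (par_mem_parSpan (List.mem_map_of_mem (by decide)))
    · rintro i ⟨hi1, hi2⟩
      obtain ⟨j, rfl⟩ : ∃ j, i = t + j := ⟨i - t, by omega⟩
      have hj1 : 1 ≤ j := by omega
      have hj2 : j ≤ 8 := by omega
      simp only [Pi.add_apply, Pi.smul_apply, smul_eq_mul, par, count_shift]
      interval_cases j <;> simp <;> assumption

lemma pairs_succ (m s : ℕ) : pairs (m + 1) s = pairs m s ++ [[m + 1, s + (m + 1)]] := by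
  simp [pairs, List.range_succ]

lemma quads_succ (s l : ℕ) :
    quads s (l + 1) = quads s l ++ octet.map (shift (s + 8 * l)) := by
  simp [quads, List.range_succ, octet, shift]

lemma length_pairs (m s : ℕ) : (pairs m s).length = m := by simp [pairs]

lemma length_quads (s l : ℕ) : (quads s l).length = 4 * l := by
  induction l with
  | zero => simp [quads]
  | succ l ih => rw [quads_succ, List.length_append, ih]; simp [octet]; ring

lemma evenBlock_pairs {m s : ℕ} (h : m ≤ s) :
    EvenBlock (pairs m s) (Set.Icc 1 m ∪ Set.Icc (s + 1) (s + m)) := by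
  -- The offset `s` stays fixed during the induction; `k ≤ m ≤ s` keeps the new pair disjoint from
  -- the earlier letters.
  have key : ∀ k ≤ m, EvenBlock (pairs k s) (Set.Icc 1 k ∪ Set.Icc (s + 1) (s + k)) := by
    intro k
    induction k with
    | zero => intro _; simpa [pairs] using EvenBlock.nil
    | succ k ih =>
      intro hk
      rw [pairs_succ]
      convert (ih (by omega)).append (EvenBlock.pair (i := k + 1) (j := s + (k + 1)) (by omega)) ?_
        using 1
      · ext i
        simp only [Set.mem_union, Set.mem_Icc, Set.mem_insert_iff, Set.mem_singleton_iff]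
        omega
      · rw [Set.disjoint_left]
        intro i
        simp only [Set.mem_union, Set.mem_Icc, Set.mem_insert_iff, Set.mem_singleton_iff]
        omega
  exact key m le_rfl

lemma evenBlock_quads (s l : ℕ) : EvenBlock (quads s l) (Set.Icc (s + 1) (s + 8 * l)) := by
  induction l with
  | zero => simpa [quads] using EvenBlock.nil
  | succ l ih =>
    rw [quads_succ]
    convert ih.append (evenBlock_octet (s + 8 * l)) ?_ using 1
    · ext i
      simp only [Set.mem_union, Set.mem_Icc]
      omega
    · rw [Set.disjoint_left]
      intro i
      simp only [Set.mem_Icc]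
      omega

/-! ### The tails in at most seven letters -/

/-- A set of words in the letters `1, …, a` such that, if each letter has square `(-1) ^ e`, the
monomials are commuting involutions that form a maximal independent set. -/
structure TailBlock (E : List (List ℕ)) (a e : ℕ) : Prop where
  supp : ∀ α ∈ E, ∀ i ∈ α, 1 ≤ i ∧ i ≤ a
  nodup : ∀ α ∈ E, α.Nodup
  overlap : EvenOverlap E
  triangular : Triangular E
  sq : ∀ α ∈ E, (α.length * (α.length - 1) / 2 + e * α.length) % 2 = 0
  maximal : ∀ w ∈ (List.range' 1 a).sublists,
    (∀ α ∈ E, (α.length * w.length + coincidences α w) % 2 = 0) →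
    (w.length * (w.length - 1) / 2 + e * w.length) % 2 = 0 →
    ∃ T ∈ E.sublists, ∀ j ∈ List.range' 1 a, (w.count j + T.flatten.count j) % 2 = 0

/-- A tail need not be self-dual: for `a = 1` the word `[1]` commutes with everything and is
excluded only by its square. Hence maximality is checked over all subsets of the letters, with the
condition on squares included. -/
lemma tailBlock_extraP {a : ℕ} (ha : a < 8) : TailBlock (extraP 0 a) a 1 := by
  refine ⟨?_, ?_, ?_, ?_, ?_, ?_⟩
  · revert a; decide
  · revert a; decide
  · unfold EvenOverlap; revert a; decide
  · interval_cases a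
    · trivial
    · trivial
    · trivial
    · exact ⟨⟨3, by decide⟩, trivial⟩
    · exact ⟨⟨4, by decide⟩, trivial⟩
    · exact ⟨⟨4, by decide⟩, ⟨5, by decide⟩, trivial⟩
    · exact ⟨⟨1, by decide⟩, ⟨2, by decide⟩, ⟨3, by decide⟩, trivial⟩
    · exact ⟨⟨1, by decide⟩, ⟨2, by decide⟩, ⟨3, by decide⟩, ⟨4, by decide⟩, trivial⟩
  · revert a; decide
  · revert a; decide +kernel

lemma tailBlock_extraQ {a : ℕ} (ha : a < 8) : TailBlock (extraQ 0 a) a 0 := by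
  refine ⟨?_, ?_, ?_, ?_, ?_, ?_⟩
  · revert a; decide
  · revert a; decide
  · unfold EvenOverlap; revert a; decide
  · interval_cases a
    · trivial
    · exact ⟨⟨1, by decide⟩, trivial⟩
    · exact ⟨⟨1, by decide⟩, trivial⟩
    · exact ⟨⟨1, by decide⟩, trivial⟩
    · exact ⟨⟨1, by decide⟩, trivial⟩
    · exact ⟨⟨4, by decide⟩, ⟨5, by decide⟩, trivial⟩
    · exact ⟨⟨4, by decide⟩, ⟨6, by decide⟩, trivial⟩
    · exact ⟨⟨4, by decide⟩, ⟨6, by decide⟩, ⟨7, by decide⟩, trivial⟩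
  · revert a; decide
  · revert a; decide +kernel

lemma extraP_eq_shift (m a : ℕ) : extraP m a = (extraP 0 a).map (shift m) := by
  unfold extraP; split <;> simp [shift]

lemma extraQ_eq_shift (m a : ℕ) : extraQ m a = (extraQ 0 a).map (shift m) := by
  unfold extraQ; split <;> simp [shift]

/-! ### Maximality of a self-dual block with a tail -/

lemma cast_coincidences (α β : List ℕ) :
    (coincidences α β : ZMod 2) = (α.map (par β)).sum := by
  induction α with
  | nil => simp [coincidences]
  | cons i α ih =>
    simp only [coincidences, List.map_cons, List.sum_cons, Nat.cast_add] at ih ⊢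
    rw [ih, par]

/-- The only scalars are 0 and 1, so a linear combination is a concatenation of words. -/
lemma exists_words_of_mem_parSpan {K : List (List ℕ)} {v : ℕ → ZMod 2} (hv : v ∈ parSpan K) :
    ∃ T ⊆ K, par T.flatten = v := by
  induction hv using Submodule.span_induction with
  | mem v hv =>
    obtain ⟨α, hα, rfl⟩ := hv
    exact ⟨[α], by simpa using hα, by simp⟩
  | zero => exact ⟨[], by simp, by ext; simp [par]⟩
  | add v w _ _ hv hw =>
    obtain ⟨T, hT, rfl⟩ := hv
    obtain ⟨T', hT', rfl⟩ := hw
    exact ⟨T ++ T', List.append_subset.2 ⟨hT, hT'⟩, by rw [List.flatten_append, par_append]⟩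
  | smul c v _ hv =>
    obtain ⟨T, hT, rfl⟩ := hv
    have hc : ∀ c : ZMod 2, c = 0 ∨ c = 1 := by decide
    rcases hc c with rfl | rfl
    · exact ⟨[], by simp, by ext; simp [par]⟩
    · exact ⟨T, hT, by rw [one_smul]⟩

namespace IsCommutingInvolutive

variable {L T : List (List ℕ)}

lemma commute_flatten {x : Cl p q} (hx : ∀ α ∈ L, Commute x (gammaMono p q α)) (hT : T ⊆ L) :
    Commute x (gammaMono p q T.flatten) := by
  induction T with
  | nil => simp
  | cons α T ih =>
    rw [List.cons_subset] at hT
    rw [List.flatten_cons, gammaMono_append]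
    exact (hx α hT.1).mul_right (ih hT.2)

lemma flatten_mul_self (h : IsCommutingInvolutive p q L) (hT : T ⊆ L) :
    gammaMono p q T.flatten * gammaMono p q T.flatten = 1 := by
  induction T with
  | nil => simp
  | cons α T ih =>
    rw [List.cons_subset] at hT
    have hc := commute_flatten (fun β hβ => h.comm α hT.1 β hβ) hT.2
    rw [List.flatten_cons, gammaMono_append, hc.symm.mul_mul_mul_comm, h.sq α hT.1, ih hT.2,
      one_mul]

lemma flatten_mul_idem (h : IsCommutingInvolutive p q L) (hT : T ⊆ L) :
    gammaMono p q T.flatten * idem p q L = idem p q L := by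
  induction T with
  | nil => simp
  | cons α T ih =>
    rw [List.cons_subset] at hT
    rw [List.flatten_cons, gammaMono_append, mul_assoc, ih hT.2, h.gammaMono_mul_idem hT.1]

end IsCommutingInvolutive

/-- Words with the same parity yield the same monomial up to sign, hence the same commutation and
the same square. -/
lemma commute_and_sq_of_par_eq {α β : List ℕ} (hα : IsWord (p + q) α) (hβ : IsWord (p + q) β)
    (h : par α = par β) :
    (∀ x, Commute (gammaMono p q β) x → Commute (gammaMono p q α) x) ∧
      gammaMono p q α * gammaMono p q α = gammaMono p q β * gammaMono p q β := by
  rcases gammaMono_of_par_eq hα hβ h with h | h <;> rw [h]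
  · exact ⟨fun _ => id, rfl⟩
  · exact ⟨fun _ => Commute.neg_left, neg_mul_neg _ _⟩

lemma gammaMono_mul_self_of_sgn {w : List ℕ} {e : ℕ} (hw : IsWord (p + q) w) (hn : w.Nodup)
    (hs : ∀ i ∈ w, sgn p i = (-1) ^ e) :
    gammaMono p q w * gammaMono p q w =
      (-1 : ℝ) ^ (w.length * (w.length - 1) / 2 + e * w.length) • 1 := by
  rw [gammaMono_mul_self_of_nodup hw hn, List.map_congr_left hs, List.map_const',
    List.prod_replicate, ← pow_mul, ← pow_add]

lemma par_shift_add (m : ℕ) (α : List ℕ) (j : ℕ) : par (shift m α) (m + j) = par α j := by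
  rw [par, count_shift, par]

/-- Self-duality of `K` removes from a commuting monomial all letters in `U`, at the cost of a
product of words of `K` that acts trivially on F. The remainder lives on the tail letters and
inherits the commutation and the square. -/
theorem isMaximal_append {K E : List (List ℕ)} {U : Set ℕ} {m a e : ℕ} (hK : EvenBlock K U)
    (hE : TailBlock E a e)
    (hU : ∀ i, 1 ≤ i → i ≤ p + q → i ∈ U ∨ ∃ j, (1 ≤ j ∧ j ≤ a) ∧ i = m + j)
    (hm : m + a ≤ p + q) (hs : ∀ j, 1 ≤ j → j ≤ a → sgn p (m + j) = (-1) ^ e)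
    (h : IsCommutingInvolutive p q (K ++ E.map (shift m))) :
    IsMaximal p q (K ++ E.map (shift m)) := by
  set L := K ++ E.map (shift m) with hL
  intro β hβ hc hsq
  have hKL : K ⊆ L := List.subset_append_left _ _
  have hEL : E.map (shift m) ⊆ L := List.subset_append_right _ _
  -- remove from `β` all letters in `U`
  obtain ⟨v, hv, hvx⟩ := hK.dual (par β) fun α hα => by
    -- Words of `K` have even length, so commuting with them is orthogonality modulo 2.
    have he := (commute_gammaMono_iff (h.word α (hKL hα)) hβ).1 (hc α (hKL hα)).symm
    have hc0 : Even (coincidences α β) := by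
      have := (Nat.even_iff.2 (hK.even α hα)).mul_right β.length
      exact (Nat.even_add.1 he).1 this
    rw [← cast_coincidences]
    exact (ZMod.natCast_eq_zero_iff_even).2 hc0
  obtain ⟨T, hT, rfl⟩ := exists_words_of_mem_parSpan hv
  have hTL : T ⊆ L := fun α hα => hKL (hT hα)
  have hTw : IsWord (p + q) T.flatten := isWord_flatten fun α hα => h.word α (hTL hα)
  have hβT : IsWord (p + q) (β ++ T.flatten) := isWord_append.2 ⟨hβ, hTw⟩
  -- replace it by a word without repetitions
  let w := (List.range' 1 a).filter fun j => par (β ++ T.flatten) (m + j) ≠ 0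
  have hwmem : ∀ j ∈ w, 1 ≤ j ∧ j ≤ a := by
    intro j hj
    have := List.mem_range'_1.1 (List.mem_of_mem_filter hj)
    omega
  have hwn : w.Nodup := (List.nodup_range').filter _
  have hww : IsWord (p + q) (shift m w) := by
    intro i hi
    obtain ⟨j, hj, rfl⟩ := mem_shift.1 hi
    have := hwmem j hj
    omega
  have h01 : ∀ x : ZMod 2, x ≠ 0 → x = 1 := by decide
  -- On `U` the parities of `β` and `T.flatten` cancel, on the tail letters `w` records their sum,
  -- and outside the alphabet both sides vanish.
  have hpar : par (shift m w) = par (β ++ T.flatten) := by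
    ext i
    by_cases hi : 1 ≤ i ∧ i ≤ p + q
    · by_cases hj : ∃ j, (1 ≤ j ∧ j ≤ a) ∧ i = m + j
      · obtain ⟨j, hj, rfl⟩ := hj
        rw [par_shift_add]
        by_cases h0 : par (β ++ T.flatten) (m + j) = 0
        · rw [h0]
          exact par_eq_zero_of_not_mem fun hmem => by simpa [h0] using List.of_mem_filter hmem
        · rw [h01 _ h0, par, List.count_eq_one_of_mem hwn, Nat.cast_one]
          refine List.mem_filter.2 ⟨List.mem_range'_1.2 (by omega), by simpa using h0⟩
      · have hiU := (hU i hi.1 hi.2).resolve_right hj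
        rw [par_append, Pi.add_apply, hvx i hiU, CharTwo.add_self_eq_zero]
        refine par_eq_zero_of_not_mem fun hmem => hj ?_
        obtain ⟨j, hj', rfl⟩ := mem_shift.1 hmem
        exact ⟨j, hwmem j hj', rfl⟩
    · rw [par_eq_zero_of_not_mem fun hmem => hi (hww i hmem),
        par_eq_zero_of_not_mem fun hmem => hi (hβT i hmem)]
  obtain ⟨hwc, hwsq⟩ := commute_and_sq_of_par_eq hww hβT hpar
  have hcT : Commute (gammaMono p q β) (gammaMono p q T.flatten) :=
    IsCommutingInvolutive.commute_flatten hc hTL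
  rw [gammaMono_append, hcT.symm.mul_mul_mul_comm, hsq, h.flatten_mul_self hTL, one_mul] at hwsq
  -- apply the maximality of the tail
  obtain ⟨T', hT', hcount⟩ := hE.maximal w (List.mem_sublists.2 List.filter_sublist)
    (fun α hα => by
      have hmem : shift m α ∈ L := hEL (List.mem_map_of_mem hα)
      have h1 : Commute (gammaMono p q (β ++ T.flatten)) (gammaMono p q (shift m α)) := by
        rw [gammaMono_append]
        exact (hc _ hmem).mul_left
          (IsCommutingInvolutive.commute_flatten (fun δ hδ => h.comm _ hmem δ hδ) hTL).symm
      have h2 := (commute_gammaMono_iff (h.word _ hmem) hww).1 (hwc _ h1).symm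
      rwa [length_shift, length_shift, coincidences_shift, Nat.even_iff] at h2)
    (by
      have h1 := gammaMono_mul_self_of_sgn (e := e) hww
        (hwn.map (add_right_injective m)) fun i hi => by
          obtain ⟨j, hj, rfl⟩ := mem_shift.1 hi
          exact hs j (hwmem j hj).1 (hwmem j hj).2
      rw [hwsq, length_shift] at h1
      rw [← Nat.even_iff]
      by_contra ho
      rw [(Nat.not_even_iff_odd.1 ho).neg_one_pow, neg_one_smul] at h1
      exact neg_one_ne_one h1.symm)
  have hT'L : T'.map (shift m) ⊆ L :=
    fun α hα => hEL (List.map_subset _ (List.mem_sublists.1 hT').subset hα)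
  have hT'supp : ∀ j ∈ T'.flatten, 1 ≤ j ∧ j ≤ a := by
    intro j hj
    obtain ⟨α, hα, hjα⟩ := List.mem_flatten.1 hj
    exact hE.supp α ((List.mem_sublists.1 hT').subset hα) j hjα
  have hpar' : par (β ++ T.flatten) = par (T'.map (shift m)).flatten := by
    rw [← hpar, shift_flatten]
    ext i
    by_cases hj : ∃ j, (1 ≤ j ∧ j ≤ a) ∧ i = m + j
    · obtain ⟨j, hj, rfl⟩ := hj
      rw [par_shift_add, par_shift_add, par, par, ZMod.natCast_eq_natCast_iff']
      have := hcount j (List.mem_range'_1.2 (by omega))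
      omega
    · rw [par_eq_zero_of_not_mem, par_eq_zero_of_not_mem]
      · intro hmem
        obtain ⟨j, hj', rfl⟩ := mem_shift.1 hmem
        exact hj ⟨j, hT'supp j hj', rfl⟩
      · intro hmem
        obtain ⟨j, hj', rfl⟩ := mem_shift.1 hmem
        exact hj ⟨j, hwmem j hj', rfl⟩
  -- F absorbs `T.flatten`, so `β` acts on F as the reduced word does.
  have hβF : gammaMono p q β * idem p q L = gammaMono p q (β ++ T.flatten) * idem p q L := by
    rw [gammaMono_append, mul_assoc, h.flatten_mul_idem hTL]
  rw [hβF]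
  rcases gammaMono_of_par_eq hβT (isWord_flatten fun α hα => h.word α (hT'L hα)) hpar' with h1 | h1
  · left; rw [h1, h.flatten_mul_idem hT'L]
  · right; rw [h1, neg_mul, h.flatten_mul_idem hT'L]

/-! ### The two families of tables -/

lemma sgn_eq_one {i : ℕ} (h : i ≤ p) : sgn p i = 1 := if_pos h

lemma sgn_eq_neg_one {i : ℕ} (h : p < i) : sgn p i = -1 := if_neg (by omega)

lemma isBasisIndex_pairs {n m s : ℕ} (hms : m ≤ s) (hn : s + m ≤ n) {α : List ℕ}
    (hα : α ∈ pairs m s) : IsBasisIndex n α := by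
  obtain ⟨i, hi, rfl⟩ := List.mem_map.1 hα
  rw [List.mem_range] at hi
  refine ⟨by simp; omega, ?_, by simp, by simp⟩
  simp only [List.mem_cons, List.not_mem_nil, or_false, forall_eq_or_imp, forall_eq]
  omega

lemma mem_quads {s l : ℕ} {α : List ℕ} :
    α ∈ quads s l ↔ ∃ i < l, ∃ δ ∈ octet, α = shift (s + 8 * i) δ := by
  simp [quads, octet, shift]

lemma isBasisIndex_shift {n m a : ℕ} {α : List ℕ} (hα : IsBasisIndex a α) (h : m + a ≤ n) :
    IsBasisIndex n (shift m α) := by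
  obtain ⟨h1, h2, h3⟩ := hα
  refine ⟨?_, ?_, by simpa using h3⟩
  · rw [shift, List.pairwise_map]
    exact h1.imp fun hab => by omega
  · intro i hi
    obtain ⟨j, hj, rfl⟩ := mem_shift.1 hi
    have := h2 j hj
    omega

lemma isBasisIndex_octet : ∀ α ∈ octet, IsBasisIndex 8 α := by
  unfold IsBasisIndex; decide

lemma isBasisIndex_quads {n s l : ℕ} (hn : s + 8 * l ≤ n) {α : List ℕ} (hα : α ∈ quads s l) :
    IsBasisIndex n α := by
  obtain ⟨i, hi, δ, hδ, rfl⟩ := mem_quads.1 hα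
  exact isBasisIndex_shift (isBasisIndex_octet δ hδ) (by omega)

lemma isBasisIndex_extraP {a : ℕ} (ha : a < 8) : ∀ α ∈ extraP 0 a, IsBasisIndex a α := by
  unfold IsBasisIndex; revert a; decide

lemma isBasisIndex_extraQ {a : ℕ} (ha : a < 8) : ∀ α ∈ extraQ 0 a, IsBasisIndex a α := by
  unfold IsBasisIndex; revert a; decide

/-- Each pair joins a letter of square 1 to one of square -1; anticommutation supplies the second
sign. -/
lemma gammaMono_pair_mul_self {m s : ℕ} (hm : m ≤ p) (hs : p ≤ s) (hn : s + m ≤ p + q)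
    {α : List ℕ} (hα : α ∈ pairs m s) : gammaMono p q α * gammaMono p q α = 1 := by
  have hb := isBasisIndex_pairs (hm.trans hs) hn hα
  rw [gammaMono_mul_self_of_nodup hb.2.1 (hb.1.imp ne_of_lt)]
  obtain ⟨i, hi, rfl⟩ := List.mem_map.1 hα
  rw [List.mem_range] at hi
  simp [sgn_eq_one (show i + 1 ≤ p by omega), sgn_eq_neg_one (show p < s + (i + 1) by omega)]

/-- Reversing four letters takes six transpositions, and the four equal squares multiply to 1. -/
lemma gammaMono_quad_mul_self {s l e : ℕ} (hn : s + 8 * l ≤ p + q)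
    (hs : ∀ i ∈ Set.Icc (s + 1) (s + 8 * l), sgn p i = (-1) ^ e)
    {α : List ℕ} (hα : α ∈ quads s l) : gammaMono p q α * gammaMono p q α = 1 := by
  have hb := isBasisIndex_quads hn hα
  rw [gammaMono_mul_self_of_sgn hb.2.1 (hb.1.imp ne_of_lt)
    fun i hi => hs i ((evenBlock_quads s l).supp α hα i hi)]
  obtain ⟨i, hi, δ, hδ, rfl⟩ := mem_quads.1 hα
  have h4 : ∀ δ ∈ octet, δ.length = 4 := by decide
  rw [length_shift, h4 δ hδ, Even.neg_one_pow (by rw [Nat.even_iff]; omega), one_smul]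

lemma isCommutingInvolutive_append {K E : List (List ℕ)} {U : Set ℕ} {m a e : ℕ}
    (hK : EvenBlock K U) (hE : TailBlock E a e)
    (hKw : ∀ α ∈ K, IsWord (p + q) α)
    (hKs : ∀ α ∈ K, gammaMono p q α * gammaMono p q α = 1)
    (hU : ∀ j, 1 ≤ j → j ≤ a → m + j ∉ U)
    (hm : m + a ≤ p + q) (hs : ∀ j, 1 ≤ j → j ≤ a → sgn p (m + j) = (-1) ^ e) :
    IsCommutingInvolutive p q (K ++ E.map (shift m)) ∧ Triangular (K ++ E.map (shift m)) := by
  have hEw : ∀ α ∈ E, IsWord (p + q) (shift m α) := by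
    intro α hα i hi
    obtain ⟨j, hj, rfl⟩ := mem_shift.1 hi
    have := hE.supp α hα j hj
    omega
  have hd : ∀ α ∈ K, ∀ β ∈ E.map (shift m), ∀ i ∈ α, i ∉ β := by
    intro α hα β hβ i hi hi'
    obtain ⟨β, hβ', rfl⟩ := List.mem_map.1 hβ
    obtain ⟨j, hj, rfl⟩ := mem_shift.1 hi'
    exact hU j (hE.supp β hβ' j hj).1 (hE.supp β hβ' j hj).2 (hK.supp α hα _ hi)
  have hword : ∀ α ∈ K ++ E.map (shift m), IsWord (p + q) α := by
    intro α hα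
    rcases List.mem_append.1 hα with hα | hα
    · exact hKw α hα
    · obtain ⟨α, hα', rfl⟩ := List.mem_map.1 hα
      exact hEw α hα'
  refine ⟨⟨hword, ?_, ?_⟩, hK.triangular.append (hE.triangular.map_shift m) hd⟩
  · intro α hα
    rcases List.mem_append.1 hα with hα | hα
    · exact hKs α hα
    · obtain ⟨α, hα', rfl⟩ := List.mem_map.1 hα
      rw [gammaMono_mul_self_of_sgn (e := e) (hEw α hα')
        ((hE.nodup α hα').map (add_right_injective m)), length_shift,
        (Nat.even_iff.2 (hE.sq α hα')).neg_one_pow, one_smul]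
      intro i hi
      obtain ⟨j, hj, rfl⟩ := mem_shift.1 hi
      exact hs j (hE.supp α hα' j hj).1 (hE.supp α hα' j hj).2
  · intro α hα β hβ
    rw [commute_gammaMono_iff (hword α hα) (hword β hβ), Nat.even_iff]
    exact hK.overlap.append (hE.overlap.map_shift m) hK.even hd α hα β hβ

theorem tableP_spec (p l : ℕ) {a : ℕ} (ha : a < 8) :
    IsCommutingInvolutive p (p + 8 * l + a) (tableP p l a) ∧ Triangular (tableP p l a) ∧
      IsMaximal p (p + 8 * l + a) (tableP p l a) := by
  have hE := tailBlock_extraP ha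
  have hK := (evenBlock_pairs (le_refl p)).append (evenBlock_quads (2 * p) l) <| by
    rw [Set.disjoint_left]
    intro i
    simp only [Set.mem_union, Set.mem_Icc]
    omega
  have hs : ∀ i, p < i → sgn p i = (-1) ^ 1 := fun i hi => by rw [sgn_eq_neg_one hi, pow_one]
  have hm : 2 * p + 8 * l + a ≤ p + (p + 8 * l + a) := by omega
  have hsE : ∀ j, 1 ≤ j → j ≤ a → sgn p (2 * p + 8 * l + j) = (-1) ^ 1 :=
    fun j _ _ => hs _ (by omega)
  rw [tableP, extraP_eq_shift, P2, P4]
  obtain ⟨h, ht⟩ := isCommutingInvolutive_append (q := p + 8 * l + a) hK hE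
    (fun α hα => (List.mem_append.1 hα).elim
      (fun hα => (isBasisIndex_pairs le_rfl (by omega) hα).2.1)
      (fun hα => (isBasisIndex_quads (by omega) hα).2.1))
    (fun α hα => (List.mem_append.1 hα).elim
      (fun hα => gammaMono_pair_mul_self le_rfl le_rfl (by omega) hα)
      (fun hα => gammaMono_quad_mul_self (by omega) (fun i hi => hs i (by have := hi.1; omega)) hα))
    (by intro j h1 h2; simp only [Set.mem_union, Set.mem_Icc]; omega) hm hsE
  refine ⟨h, ht, isMaximal_append hK hE ?_ hm hsE h⟩
  intro i h1 h2
  by_cases hi : i ≤ 2 * p + 8 * l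
  · left
    simp only [Set.mem_union, Set.mem_Icc]
    omega
  · exact Or.inr ⟨i - (2 * p + 8 * l), by omega, by omega⟩

theorem tableQ_spec (q l : ℕ) {a : ℕ} (ha : a < 8) :
    IsCommutingInvolutive (q + 8 * l + a) q (tableQ q l a) ∧ Triangular (tableQ q l a) ∧
      IsMaximal (q + 8 * l + a) q (tableQ q l a) := by
  have hE := tailBlock_extraQ ha
  have hK := (evenBlock_pairs (show q ≤ q + 8 * l + a by omega)).append (evenBlock_quads q l) <| by
    rw [Set.disjoint_left]
    intro i
    simp only [Set.mem_union, Set.mem_Icc]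
    omega
  have hs : ∀ i ≤ q + 8 * l + a, sgn (q + 8 * l + a) i = (-1) ^ 0 :=
    fun i hi => by rw [sgn_eq_one hi, pow_zero]
  have hm : q + 8 * l + a ≤ q + 8 * l + a + q := by omega
  have hsE : ∀ j, 1 ≤ j → j ≤ a → sgn (q + 8 * l + a) (q + 8 * l + j) = (-1) ^ 0 :=
    fun j _ _ => hs _ (by omega)
  rw [tableQ, extraQ_eq_shift, Q2, Q4]
  obtain ⟨h, ht⟩ := isCommutingInvolutive_append (p := q + 8 * l + a) hK hE
    (fun α hα => (List.mem_append.1 hα).elim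
      (fun hα => (isBasisIndex_pairs (by omega) (by omega) hα).2.1)
      (fun hα => (isBasisIndex_quads (by omega) hα).2.1))
    (fun α hα => (List.mem_append.1 hα).elim
      (fun hα => gammaMono_pair_mul_self (by omega) le_rfl (by omega) hα)
      (fun hα => gammaMono_quad_mul_self (by omega) (fun i hi => hs i (by have := hi.2; omega)) hα))
    (by intro j h1 h2; simp only [Set.mem_union, Set.mem_Icc]; omega) hm hsE
  refine ⟨h, ht, isMaximal_append hK hE ?_ hm hsE h⟩
  intro i h1 h2
  by_cases hi : q + 8 * l < i ∧ i ≤ q + 8 * l + a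
  · exact Or.inr ⟨i - (q + 8 * l), by omega, by omega⟩
  · left
    simp only [Set.mem_union, Set.mem_Icc]
    omega

/-! ### Indices, lengths and Radon–Hurwitz numbers -/

lemma isBasisIndex_tableP {p l a : ℕ} (ha : a < 8) {α : List ℕ} (hα : α ∈ tableP p l a) :
    IsBasisIndex (p + (p + 8 * l + a)) α := by
  rw [tableP, extraP_eq_shift, List.mem_append, List.mem_append] at hα
  rcases hα with (hα | hα) | hα
  · exact isBasisIndex_pairs le_rfl (by omega) hα
  · exact isBasisIndex_quads (by omega) hα
  · obtain ⟨δ, hδ, rfl⟩ := List.mem_map.1 hα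
    exact isBasisIndex_shift (isBasisIndex_extraP ha δ hδ) (by omega)

lemma isBasisIndex_tableQ {q l a : ℕ} (ha : a < 8) {α : List ℕ} (hα : α ∈ tableQ q l a) :
    IsBasisIndex (q + 8 * l + a + q) α := by
  rw [tableQ, extraQ_eq_shift, List.mem_append, List.mem_append] at hα
  rcases hα with (hα | hα) | hα
  · exact isBasisIndex_pairs (by omega) (by omega) hα
  · exact isBasisIndex_quads (by omega) hα
  · obtain ⟨δ, hδ, rfl⟩ := List.mem_map.1 hα
    exact isBasisIndex_shift (isBasisIndex_extraQ ha δ hδ) (by omega)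

lemma length_tableP (p l : ℕ) {a : ℕ} (ha : a < 8) : (tableP p l a).length = kP p l a := by
  rw [tableP, List.length_append, List.length_append, P2, P4, length_pairs, length_quads]
  interval_cases a <;> rfl

lemma length_tableQ (q l : ℕ) {a : ℕ} (ha : a < 8) : (tableQ q l a).length = kQ q l a := by
  rw [tableQ, List.length_append, List.length_append, Q2, Q4, length_pairs, length_quads]
  interval_cases a <;> rfl

lemma radonHurwitzNat_add (l a : ℕ) :
    radonHurwitzNat (8 * l + a) = radonHurwitzNat a + 4 * l := by
  induction l with
  | zero => simp
  | succ l ih =>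
    rw [show 8 * (l + 1) + a = 8 * l + a + 8 by ring, radonHurwitzNat, ih]
    push_cast
    ring

lemma radonHurwitz_neg (i : ℕ) :
    radonHurwitz (-((i : ℤ) + 2)) = 1 - ((i : ℤ) + 2) + radonHurwitzNat i := by
  rw [show -((i : ℤ) + 2) = Int.negSucc (i + 1) by rw [Int.negSucc_eq]; push_cast; ring]
  rfl

lemma kP_eq (p l : ℕ) {a : ℕ} (ha : a < 8) :
    (kP p l a : ℤ) = ((p + 8 * l + a : ℕ) : ℤ) -
      radonHurwitz (((p + 8 * l + a : ℕ) : ℤ) - (p : ℤ)) := by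
  rw [show ((p + 8 * l + a : ℕ) : ℤ) - (p : ℤ) = Int.ofNat (8 * l + a) by
    rw [Int.ofNat_eq_natCast]; push_cast; ring, radonHurwitz, radonHurwitzNat_add]
  interval_cases a <;> simp [kP, radonHurwitzNat] <;> ring

lemma kQ_eq (q l : ℕ) {a : ℕ} (ha : a < 8) :
    (kQ q l a : ℤ) = (q : ℤ) - radonHurwitz ((q : ℤ) - ((q + 8 * l + a : ℕ) : ℤ)) := by
  rw [show (q : ℤ) - ((q + 8 * l + a : ℕ) : ℤ) = -((8 * l + a : ℕ) : ℤ) by push_cast; ring]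
  by_cases h2 : 2 ≤ a
  · obtain ⟨b, rfl⟩ : ∃ b, a = b + 2 := ⟨a - 2, by omega⟩
    rw [show ((8 * l + (b + 2) : ℕ) : ℤ) = ((8 * l + b : ℕ) : ℤ) + 2 by push_cast; ring,
      radonHurwitz_neg, radonHurwitzNat_add]
    have hb : b < 6 := by omega
    interval_cases b <;> simp [kQ, radonHurwitzNat] <;> ring
  -- For `a < 2` the reflection formula needs `8 * l + a ≥ 2`. When `l = 0` the values r₀ and r₋₁
  -- are used directly; otherwise a whole period supplies the missing 2, leaving the index `8 * l +
  -- (a + 6)`.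
  · cases l with
    | zero =>
      have ha' : a < 2 := by omega
      interval_cases a
      · simp [kQ, radonHurwitz, radonHurwitzNat]
      · change ((q + 4 * 0 + 1 : ℕ) : ℤ) = q - (-1)
        push_cast
        ring
    | succ l =>
      rw [show ((8 * (l + 1) + a : ℕ) : ℤ) = ((8 * l + (a + 6) : ℕ) : ℤ) + 2 by push_cast; ring,
        radonHurwitz_neg, radonHurwitzNat_add]
      have ha' : a < 2 := by omega
      interval_cases a <;> simp [kQ, radonHurwitzNat] <;> ring

lemma exists_offset {m n : ℕ} (h : m ≤ n) : ∃ l a : ℕ, a < 8 ∧ n = m + 8 * l + a :=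
  ⟨(n - m) / 8, (n - m) % 8, by omega, by omega⟩

end CliffordTables

end

open CliffordTables in
theorem mainTheorem1 :
    -- every signature is of one of the two forms
    (∀ p q : ℕ, (∃ l a : ℕ, a < 8 ∧ q = p + 8 * l + a) ∨ (∃ l a : ℕ, a < 8 ∧ p = q + 8 * l + a)) ∧
    -- signatures `(p, p + 8l + a)`
    (∀ p l a : ℕ, a < 8 →
      (∀ α ∈ tableP p l a, IsBasisIndex (p + (p + 8 * l + a)) α) ∧
      IsGeneratingSet p (p + 8 * l + a) (gammaSet p (p + 8 * l + a) (tableP p l a)) ∧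
      (gammaSet p (p + 8 * l + a) (tableP p l a)).ncard = kP p l a ∧
      (tableP p l a).length = kP p l a ∧
      IsPrimitiveIdempotent (idem p (p + 8 * l + a) (tableP p l a)) ∧
      IsAtom (leftIdeal (idem p (p + 8 * l + a) (tableP p l a))) ∧
      kP p l a ≤ p + (p + 8 * l + a) ∧
      Module.finrank ℝ (leftIdeal (idem p (p + 8 * l + a) (tableP p l a))) =
        2 ^ (p + (p + 8 * l + a) - kP p l a)) ∧
    -- signatures `(q + 8l + a, q)`
    (∀ q l a : ℕ, a < 8 →
      (∀ α ∈ tableQ q l a, IsBasisIndex (q + 8 * l + a + q) α) ∧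
      IsGeneratingSet (q + 8 * l + a) q (gammaSet (q + 8 * l + a) q (tableQ q l a)) ∧
      (gammaSet (q + 8 * l + a) q (tableQ q l a)).ncard = kQ q l a ∧
      (tableQ q l a).length = kQ q l a ∧
      IsPrimitiveIdempotent (idem (q + 8 * l + a) q (tableQ q l a)) ∧
      IsAtom (leftIdeal (idem (q + 8 * l + a) q (tableQ q l a))) ∧
      kQ q l a ≤ q + 8 * l + a + q ∧
      Module.finrank ℝ (leftIdeal (idem (q + 8 * l + a) q (tableQ q l a))) =
        2 ^ (q + 8 * l + a + q - kQ q l a)) := by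
  refine ⟨fun p q => (le_total p q).imp exists_offset exists_offset, ?_, ?_⟩
  · intro p l a ha
    obtain ⟨h, ht, hm⟩ := tableP_spec p l ha
    have hlen := length_tableP p l ha
    exact ⟨fun α hα => isBasisIndex_tableP ha hα,
      h.isGeneratingSet ht (by rw [hlen]; exact kP_eq p l ha), hlen ▸ h.ncard_gammaSet ht, hlen,
      h.isPrimitiveIdempotent ht hm, h.isAtom_leftIdeal ht hm, hlen ▸ h.length_le ht,
      hlen ▸ h.finrank_leftIdeal_eq ht⟩
  · intro q l a ha
    obtain ⟨h, ht, hm⟩ := tableQ_spec q l ha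
    have hlen := length_tableQ q l ha
    exact ⟨fun α hα => isBasisIndex_tableQ ha hα,
      h.isGeneratingSet ht (by rw [hlen]; exact kQ_eq q l ha), hlen ▸ h.ncard_gammaSet ht, hlen,
      h.isPrimitiveIdempotent ht hm, h.isAtom_leftIdeal ht hm, hlen ▸ h.length_le ht,
      hlen ▸ h.finrank_leftIdeal_eq ht⟩
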